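/- Let $D$ be a connected oriented link diagram on the sphere with $c(D)\ge 1$ crossings that is reduced, i.e. has no nugatory crossing. Let $s(D)$ be its number of Seifert circles, $\chi(D)=s(D)-c(D)$ its canonical Euler characteristic, and $n(D)$ its number of link components. At each crossing exactly two of the four adjacent corners contain no arc of the smoothed (Seifert) diagram; the regions containing these two corners are called the non-Seifert circle regions of the crossing. Two crossings are $\sim$-equivalent if they have the same unordered pair of non-Seifert circle regions (equivalently, if flypes can make them form a reversely oriented clasp). Let $t(D)$ be the number of $\sim$-equivalence classes, and call $D$ $\bar t'_2$-irreducible if every $\sim$-equivalence class consists of at most two crossings. **Theorem 3.1.** If $\chi(D)\le 0$, then $$t(D)\le\begin{cases}-3\chi(D)&\text{if }\chi(D)<0,\\ 1&\text{if }\chi(D)=0.\end{cases}$$ If moreover $D$ is $\bar t'_2$-irreducible, then $$c(D)\le\begin{cases}4&\text{if }\chi(D)=-1\text{ and }n(D)=1,\\ 2&\text{if }\chi(D)=0,\\ -6\chi(D)&\text{if }\chi(D)<0\text{ and }n(D)=2-\chi(D),\\ -5\chi(D)+n(D)-3&\text{otherwise.}\end{cases}$$ For every $g\ge 2$, the maximal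 crossing number of a connected reduced alternating $\bar t'_2$-irreducible knot diagram $D$ of genus $g$ (that is, $n(D)=1$ and $\chi(D)=1-2g$) is exactly $10g-7$. -/

import Mathlib

/-- The number of cycles (orbits, fixed points included) of a permutation. -/
noncomputable def numCycles {α : Type*} (f : Equiv.Perm α) : ℕ :=
  Nat.card (Quotient (Equiv.Perm.SameCycle.setoid f))

/-- The combinatorial code of an oriented link diagram with set of crossings `X` in which every
component passes through a crossing.

Turn each crossing so that its two strands point upwards.  Its two outgoing ends (north-west and
north-east) and its two incoming ends (south-west and south-east) are labelled by a Boolean: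
`false` is the left one (west) and `true` is the right one (east).  The two strands through the
crossing are south-west to north-east and south-east to north-west.

* `next (x, b) = (y, b')` says that the edge of the diagram leaving the crossing `x` at its outgoing
  end `b` arrives at the crossing `y` at its incoming end `b'`.
* `positive x` is the over/under information: at a positive crossing the strand from south-west to
  north-east is the overpass, at a negative one it is the underpass. -/
structure DiagramCode (X : Type*) where
  next : Equiv.Perm (X × Bool)
  positive : X → Bool

namespace DiagramCode

variable {X : Type*} (D : DiagramCode X)

/-- The underlying 4-valent graph of the diagram (loops and multiplicities forgotten). -/
def shadow : SimpleGraph X :=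
  SimpleGraph.fromRel fun x y => ∃ b b' : Bool, D.next (x, b) = (y, b')

/-- The half-edges of the diagram: `Sum.inl (x, b)` is the outgoing end `b` at the crossing `x`, and
`Sum.inr (x, b)` is the incoming end `b` at `x`. -/
abbrev Dart (X : Type*) : Type _ := (X × Bool) ⊕ (X × Bool)

/-- The involution exchanging the two half-edges of each edge. -/
def opposite : Equiv.Perm (Dart X) where
  toFun
    | Sum.inl s => Sum.inr (D.next s)
    | Sum.inr t => Sum.inl (D.next.symm t)
  invFun
    | Sum.inl s => Sum.inr (D.next s)
    | Sum.inr t => Sum.inl (D.next.symm t)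
  left_inv := by rintro (s | t) <;> simp
  right_inv := by rintro (s | t) <;> simp

/-- The counterclockwise rotation of the four half-edges around each crossing:
north-east, north-west, south-west, south-east, north-east. -/
def rotation (X : Type*) : Equiv.Perm (Dart X) where
  toFun
    | Sum.inl (x, true) => Sum.inl (x, false)
    | Sum.inl (x, false) => Sum.inr (x, false)
    | Sum.inr (x, false) => Sum.inr (x, true)
    | Sum.inr (x, true) => Sum.inl (x, true)
  invFun
    | Sum.inl (x, false) => Sum.inl (x, true)
    | Sum.inr (x, false) => Sum.inl (x, false)
    | Sum.inr (x, true) => Sum.inr (x, false)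
    | Sum.inl (x, true) => Sum.inr (x, true)
  left_inv := by rintro (⟨x, _ | _⟩ | ⟨x, _ | _⟩) <;> rfl
  right_inv := by rintro (⟨x, _ | _⟩ | ⟨x, _ | _⟩) <;> rfl

/-- Walking from a crossing along a half-edge, with a region on the left-hand side, to the next
crossing, and turning left there.  The cycles are the boundary walks of the regions. -/
def facePerm : Equiv.Perm (Dart X) :=
  D.opposite.trans (rotation X).symm

/-- The regions of a connected diagram (the faces of the underlying map). -/
abbrev Region : Type _ := Quotient (Equiv.Perm.SameCycle.setoid D.facePerm)

/-- The region containing the corner between a half-edge and the next one counterclockwise. -/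
def cornerRegion (d : Dart X) : D.Region :=
  Quotient.mk (Equiv.Perm.SameCycle.setoid D.facePerm) d

/-- The four regions at a crossing whose strands point upwards. -/
def north (x : X) : D.Region := D.cornerRegion (Sum.inl (x, true))
def west (x : X) : D.Region := D.cornerRegion (Sum.inl (x, false))
def south (x : X) : D.Region := D.cornerRegion (Sum.inr (x, false))
def east (x : X) : D.Region := D.cornerRegion (Sum.inr (x, true))

/-- The number of crossings `c(D)`. -/
noncomputable def crossingNumber (_D : DiagramCode X) : ℕ := Nat.card X

/-- The number `n(D)` of link components: a strand arriving at an incoming end goes straight through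
the crossing and leaves at the outgoing end of the other side. -/
noncomputable def numComponents : ℕ :=
  numCycles (D.next.trans ((Equiv.refl X).prodCongr Equiv.boolNot))

/-- The number `s(D)` of Seifert circles: after smoothing every crossing along the orientation, a
strand arriving at an incoming end leaves at the outgoing end of the same side. -/
noncomputable def numSeifertCircles : ℕ := numCycles D.next

/-- The canonical Euler characteristic `χ(D) = s(D) - c(D)`. -/
noncomputable def eulerChar : ℤ := (D.numSeifertCircles : ℤ) - (D.crossingNumber : ℤ)

/-- A crossing is nugatory if two opposite corners at it lie in the same region, that is, if some
simple closed curve meets the diagram only in this crossing and passes through it from one corner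
to the opposite one. -/
def Nugatory (x : X) : Prop := D.north x = D.south x ∨ D.west x = D.east x

/-- A diagram is reduced if it has no nugatory crossing. -/
def Reduced : Prop := ∀ x, ¬ D.Nugatory x

/-- The unordered pair of the non-Seifert circle regions of a crossing.  Smoothing the crossing
leaves one Seifert circle arc in the western and one in the eastern corner, so these are the
northern and the southern region. -/
def nonSeifertRegions (x : X) : Sym2 D.Region := s(D.north x, D.south x)

/-- The relation `∼`: two crossings are equivalent if they share the same pair of non-Seifert circle
regions (equivalently, flypes can make them form a reverse clasp). -/
def simSetoid : Setoid X := Setoid.ker D.nonSeifertRegions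

/-- The number `t(D)` of `∼`-equivalence classes of crossings. -/
noncomputable def numSimClasses : ℕ := Nat.card (Quotient D.simSetoid)

/-- Every `∼`-equivalence class consists of at most two crossings. -/
def Irreducible : Prop := ∀ x, Nat.card {y : X // D.simSetoid x y} ≤ 2

/-- The strand leaving at the given outgoing end is the overpass of its crossing. -/
def outOver (s : X × Bool) : Prop := s.2 = D.positive s.1

/-- The strand arriving at the given incoming end is the overpass of its crossing. -/
def inOver (t : X × Bool) : Prop := t.2 ≠ D.positive t.1

/-- Along every edge, the diagram passes from over to under or from under to over. -/
def Alternating : Prop := ∀ s, D.outOver s ↔ ¬ D.inOver (D.next s)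

end DiagramCode

/-- A connected oriented link diagram with at least one crossing: a code whose underlying 4-valent
graph is connected and which has genus zero, `V - E + F = 2` with `V = c` and `E = 2 c`. -/
structure ConnectedLinkDiagram (X : Type*) extends DiagramCode X where
  connected : toDiagramCode.shadow.Connected
  planar : Nat.card toDiagramCode.Region = Nat.card X + 2

/-!
The proof of the upper bounds avoids planar graph theory.  Let `circle s` be the Seifert circle through
an end `s`, and call the crossings attached to a circle from the left or from the right its two sides.
A circle is *gluing* if both sides are non-empty.  Going around a circle, the region on a fixed side
changes exactly at the crossings on that side, from the southern to the northern region
(`sum_side_north`).  Hence a side with one crossing makes it nugatory, and the two crossings at a side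
with two of them, a *bigon*, are equivalent.

*Counting.*  The sides have `2 c` crossings in total, every non-empty side has at least two, and there
are `s + g` non-empty sides, where `g` is the number of gluing circles.  Since the two crossings of a
bigon are equivalent, a `∼`-class with `m` crossings contains at most `m - 1` bigons, except that a
*full* class, at which all sides are bigons, contains `m`.  A full class which meets no gluing circle is
the whole diagram, by connectedness, and then `χ = 0` and `t = 1`; otherwise it can be charged to a
gluing side.  This gives `t ≤ -3 χ` (`numSimClasses_le`).

*Components.*  Let `u` be a function modulo 2 on the regions with `u N + u S + u E + u W = 0` at all
crossings.  Its jumps across the edges are constant along each link component and determine it up to a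
constant, so that the space of solutions has dimension at most `n + 1`.  As there are `c + 2`
regions, the transposed system has a solution space of dimension at most `n - 1`.  It contains the
coboundaries `u N + u S` which vanish at the crossings not equivalent to any other one and along all
gluing circles: equivalent crossings cancel in pairs, and around a circle with one empty side the sum
telescopes.  Coboundaries form a space of dimension at least `c + 1 - s`, and the number of conditions is
small, since those along one side sum to zero (`crossingNumber_add_two_le_of_irreducible`).  Together
with the count of bigons this is the bound on the number of crossings of irreducible diagrams, except
when every crossing is equivalent to another one and all gluing sides belong to different full classes.
Then either there is no gluing circle and `n ≥ 2 - χ`, or connectedness leaves only two classes and at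
most four crossings (`crossingNumber_le`).

*Sharpness.*  A special diagram is given by two permutations of its crossings, along the circles on the
left and on the right, and its regions, circles and components are cycles of simple products of them.
A triangulation of the sphere with `2 g + 1` vertices, in which the edges of a Hamiltonian cycle are kept
simple and all others are doubled, has `10 g - 7` edges and faces coloured by the two sides of the cycle,
so that it defines such a diagram of genus `g`.  With all diagonals inside the polygon from one vertex
and all diagonals outside from a neighbouring one, the diagram is a knot diagram
(`ConnectedLinkDiagram.family`).
-/

namespace DiagramCode

/-! ### Sides of Seifert circles -/

section Sides

open scoped Classical

variable {X : Type*} (D : DiagramCode X)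

/-- The Seifert circles, that is, the cycles of `next`. -/
abbrev SeifertCircle : Type _ := Quotient (Equiv.Perm.SameCycle.setoid D.next)

/-- The Seifert circle through the edge leaving at the given outgoing end.  It also runs through the
incoming end with the same label, because smoothing joins the two. -/
def circle (s : X × Bool) : D.SeifertCircle :=
  Quotient.mk (Equiv.Perm.SameCycle.setoid D.next) s

theorem circle_next (s : X × Bool) : D.circle (D.next s) = D.circle s :=
  Quotient.sound (Equiv.Perm.sameCycle_apply_left.2 (Equiv.Perm.SameCycle.refl _ _))

theorem exists_circle_eq (C : D.SeifertCircle) : ∃ s, D.circle s = C := Quotient.exists_rep C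

/-- The eastern region for `true`, the western one for `false`. -/
def lateral (s : X × Bool) : D.Region := if s.2 then D.east s.1 else D.west s.1

/-- The region on the left (`b = true`) or on the right (`b = false`) of the edge leaving at `s`. -/
def outSide (b : Bool) (s : X × Bool) : D.Region :=
  if s.2 = b then D.north s.1 else D.lateral s

/-- The region on the left (`b = true`) or on the right (`b = false`) of the edge arriving at `s`. -/
def inSide (b : Bool) (s : X × Bool) : D.Region :=
  if s.2 = b then D.south s.1 else D.lateral s

theorem cornerRegion_facePerm (d : Dart X) :
    D.cornerRegion (D.facePerm d) = D.cornerRegion d :=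
  Quotient.sound (Equiv.Perm.sameCycle_apply_left.2 (Equiv.Perm.SameCycle.refl _ _))

theorem inSide_next (b : Bool) (s : X × Bool) : D.inSide b (D.next s) = D.outSide b s := by
  have h1 := D.cornerRegion_facePerm (Sum.inl s)
  have h2 := D.cornerRegion_facePerm (Sum.inr (D.next s))
  obtain ⟨x, b'⟩ := s
  generalize hy : D.next (x, b') = t at *
  obtain ⟨y, b''⟩ := t
  have hy' : D.next.symm (y, b'') = (x, b') := by rw [← hy]; simp
  cases b <;> cases b' <;> cases b'' <;>
    simp_all [inSide, outSide, lateral, north, south, east, west, facePerm, opposite, rotation]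

/-- Every region is one of the four regions at some crossing. -/
theorem exists_corner (r : D.Region) :
    ∃ x, r = D.north x ∨ r = D.south x ∨ r = D.east x ∨ r = D.west x := by
  obtain ⟨d, rfl⟩ := Quotient.exists_rep r
  rcases d with ⟨x, _ | _⟩ | ⟨x, _ | _⟩
  · exact ⟨x, Or.inr (Or.inr (Or.inr rfl))⟩
  · exact ⟨x, Or.inl rfl⟩
  · exact ⟨x, Or.inr (Or.inl rfl)⟩
  · exact ⟨x, Or.inr (Or.inr (Or.inl rfl))⟩

/-- A non-empty set of crossings closed under following edges forwards contains all crossings of a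
connected diagram.  Edges may be followed backwards too, since `next` has finite order. -/
theorem forall_of_closed [Finite X] (hD : D.shadow.Connected) {P : X → Prop}
    (hP : ∀ x b, P x → P (D.next (x, b)).1) {x₀ : X} (h₀ : P x₀) (x : X) : P x := by
  have hpow : ∀ (n : ℕ) (s : X × Bool), P s.1 → P ((D.next ^ n) s).1 := by
    intro n
    induction n with
    | zero => intro s hs; simpa using hs
    | succ n ih =>
      intro s hs
      rw [pow_succ', Equiv.Perm.mul_apply]
      exact hP _ _ (ih s hs)
  have hback : ∀ s : X × Bool, P (D.next s).1 → P s.1 := by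
    intro s hs
    obtain ⟨n, -, hn⟩ := (Equiv.Perm.sameCycle_apply_left.2
      (Equiv.Perm.SameCycle.refl D.next s)).exists_pow_eq'
    rw [← hn]
    exact hpow n _ hs
  have hadj : ∀ y z, D.shadow.Adj y z → P y → P z := by
    intro y z hyz hy
    rw [shadow, SimpleGraph.fromRel_adj] at hyz
    rcases hyz.2 with ⟨b, b', h⟩ | ⟨b, b', h⟩
    · have := hP y b hy
      rwa [h] at this
    · have := hback (z, b) (by rw [h]; exact hy)
      exact this
  obtain ⟨p⟩ := hD.preconnected x₀ x
  induction p with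
  | nil => exact h₀
  | cons h _ ih => exact ih (hadj _ _ h h₀)

/-- A function on the regions of a connected diagram which takes a single value around each crossing
is constant. -/
theorem eq_of_forall_corner [Finite X] (hD : D.shadow.Connected) {M : Type*} {u : D.Region → M}
    (hs : ∀ x, u (D.south x) = u (D.north x)) (he : ∀ x, u (D.east x) = u (D.north x))
    (hw : ∀ x, u (D.west x) = u (D.north x)) (r r' : D.Region) : u r = u r' := by
  have hcorner : ∀ r, ∃ x, u r = u (D.north x) := by
    intro r
    obtain ⟨x, rfl | rfl | rfl | rfl⟩ := D.exists_corner r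
    exacts [⟨x, rfl⟩, ⟨x, hs x⟩, ⟨x, he x⟩, ⟨x, hw x⟩]
  have hlat : ∀ s, u (D.lateral s) = u (D.north s.1) := by
    rintro ⟨x, _ | _⟩
    · simpa [lateral] using hw x
    · simpa [lateral] using he x
  have hnext : ∀ s, u (D.north (D.next s).1) = u (D.north s.1) := by
    intro s
    have h := congrArg u (D.inSide_next true s)
    have h1 : u (D.inSide true (D.next s)) = u (D.north (D.next s).1) := by
      unfold inSide; split_ifs
      exacts [hs _, hlat _]
    have h2 : u (D.outSide true s) = u (D.north s.1) := by
      unfold outSide; split_ifs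
      exacts [rfl, hlat _]
    rw [← h1, h, h2]
  obtain ⟨x, hx⟩ := hcorner r
  obtain ⟨y, hy⟩ := hcorner r'
  rw [hx, hy]
  exact D.forall_of_closed hD (P := fun z => u (D.north z) = u (D.north y))
    (fun z b hz => (hnext (z, b)).trans hz) rfl x

variable [Fintype X]

/-- The crossings attached to the Seifert circle `C` from the left (`b = true`) or from the right
(`b = false`): a crossing lies to the left of the circle through its eastern ends and to the right of
the circle through its western ends. -/
noncomputable def side (C : D.SeifertCircle) (b : Bool) : Finset X :=
  Finset.univ.filter fun x => D.circle (x, b) = C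

theorem mem_side {C : D.SeifertCircle} {b : Bool} {x : X} :
    x ∈ D.side C b ↔ D.circle (x, b) = C := by simp [side]

/-- A Seifert circle is gluing if crossings are attached to it from both sides. -/
def Gluing (C : D.SeifertCircle) : Prop := ∀ b, (D.side C b).Nonempty

theorem sum_side {M : Type*} [AddCommMonoid M] (b : Bool) (f : X → M) :
    ∑ C, ∑ x ∈ D.side C b, f x = ∑ x, f x := by
  unfold side
  exact Finset.sum_fiberwise _ _ _

/-- Going once around a Seifert circle, the region on a fixed side changes exactly at the crossings
attached from that side, from the southern to the northern one. -/
theorem sum_side_north {M : Type*} [AddCommGroup M] (u : D.Region → M) (C : D.SeifertCircle)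
    (b : Bool) : ∑ x ∈ D.side C b, u (D.north x) = ∑ x ∈ D.side C b, u (D.south x) := by
  have h : ∑ s : X × Bool, (if D.circle s = C then u (D.outSide b s) - u (D.inSide b s) else 0)
      = 0 := by
    have h1 : ∑ s : X × Bool, (if D.circle s = C then u (D.outSide b s) else 0)
        = ∑ s : X × Bool, (if D.circle s = C then u (D.inSide b s) else 0) := by
      rw [← Equiv.sum_comp D.next fun s => if D.circle s = C then u (D.inSide b s) else 0]
      simp only [circle_next, inSide_next]
    rw [← sub_eq_zero, ← Finset.sum_sub_distrib] at h1
    refine Eq.trans (Finset.sum_congr rfl fun s _ => ?_) h1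
    split_ifs <;> simp
  rw [Fintype.sum_prod_type] at h
  rw [← sub_eq_zero, ← Finset.sum_sub_distrib, ← h]
  unfold side
  rw [Finset.sum_filter]
  refine Finset.sum_congr rfl fun x _ => ?_
  rw [Fintype.sum_bool]
  cases b <;> simp [outSide, inSide]

/-- If no crossing is attached to a Seifert circle from one side, then the region on that side is the
same all along the circle. -/
theorem lateral_eq_of_side_eq_empty {C : D.SeifertCircle} {b : Bool}
    (h : D.side C (!b) = ∅) {s t : X × Bool} (hs : D.circle s = C) (ht : D.circle t = C) :
    D.lateral s = D.lateral t := by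
  have hb : ∀ s, D.circle s = C → s.2 = b := by
    rintro ⟨x, b'⟩ hs
    by_contra hne
    have hb' : b' = !b := by cases b <;> cases b' <;> simp_all
    subst hb'
    have : x ∈ D.side C (!b) := D.mem_side.2 hs
    simp [h] at this
  have hstep : ∀ s, D.circle s = C → D.lateral (D.next s) = D.lateral s := by
    intro s hs
    have h1 := hb s hs
    have h2 := hb (D.next s) ((D.circle_next s).trans hs)
    have h3 := D.inSide_next (!b) s
    simpa [inSide, outSide, h1, h2] using h3
  have hpow : ∀ n : ℕ, D.circle ((D.next ^ n) s) = C ∧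
      D.lateral ((D.next ^ n) s) = D.lateral s := by
    intro n
    induction n with
    | zero => simpa using hs
    | succ n ih =>
      rw [pow_succ', Equiv.Perm.mul_apply]
      exact ⟨(D.circle_next _).trans ih.1, (hstep _ ih.1).trans ih.2⟩
  have hst : D.next.SameCycle s t := Quotient.exact (hs.trans ht.symm)
  obtain ⟨n, -, hn⟩ := hst.exists_pow_eq'
  rw [← hn, (hpow n).2]

end Sides

section LinearAlgebra

open scoped Classical

/-! ### Solutions of the corner equations modulo 2 -/

theorem apply_eq_of_sameCycle {α M : Type*} [Finite α] {f : Equiv.Perm α} {g : α → M}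
    (hg : ∀ a, g (f a) = g a) {a b : α} (h : f.SameCycle a b) : g a = g b := by
  obtain ⟨n, -, rfl⟩ := h.exists_pow_eq'
  induction n with
  | zero => rfl
  | succ n ih =>
    rw [pow_succ', Equiv.Perm.mul_apply, hg]
    exact ih ⟨n, by simp⟩

theorem finrank_invariant_eq_numCycles {α : Type*} [Finite α] (f : Equiv.Perm α) :
    Module.finrank (ZMod 2) (Quotient (Equiv.Perm.SameCycle.setoid f) → ZMod 2) = numCycles f := by
  have := Fintype.ofFinite α
  rw [Module.finrank_fintype_fun_eq_card, numCycles, Nat.card_eq_fintype_card]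

variable {X : Type*} (D : DiagramCode X)

/-- The difference of a function on the regions across each crossing, modulo 2. -/
def coboundary : (D.Region → ZMod 2) →ₗ[ZMod 2] (X → ZMod 2) where
  toFun u x := u (D.north x) + u (D.south x)
  map_add' u v := by ext x; simp; ring
  map_smul' a u := by ext x; simp; ring

theorem coboundary_apply (u : D.Region → ZMod 2) (x : X) :
    D.coboundary u x = u (D.north x) + u (D.south x) := rfl

variable [Fintype X]

/-- The incidence matrix modulo 2 between the crossings and the corners of the regions. -/
noncomputable def cornerMatrix : Matrix X D.Region (ZMod 2) :=
  Matrix.of fun x => Pi.single (D.north x) 1 + Pi.single (D.south x) 1 + Pi.single (D.east x) 1 +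
    Pi.single (D.west x) 1

theorem cornerMatrix_mulVec (u : D.Region → ZMod 2) (x : X) :
    D.cornerMatrix.mulVec u x =
      u (D.north x) + u (D.south x) + u (D.east x) + u (D.west x) := by
  change (Pi.single (D.north x) 1 + Pi.single (D.south x) 1 + Pi.single (D.east x) 1 +
    Pi.single (D.west x) 1) ⬝ᵥ u = _
  simp [add_dotProduct]

/-- A solution of the corner equations is a colouring of the regions; its jumps across the edges are
constant along each link component, and they determine it up to a constant. -/
theorem finrank_ker_cornerMatrix_le (hD : D.shadow.Connected) :
    Module.finrank (ZMod 2) (LinearMap.ker D.cornerMatrix.mulVecLin) ≤ D.numComponents + 1 := by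
  obtain ⟨x₀⟩ := hD.nonempty
  let f : Equiv.Perm (X × Bool) := D.next.trans ((Equiv.refl X).prodCongr Equiv.boolNot)
  let Comp := Quotient (Equiv.Perm.SameCycle.setoid f)
  have hinv : ∀ u ∈ LinearMap.ker D.cornerMatrix.mulVecLin, ∀ s,
      u (D.outSide true (f s)) + u (D.outSide false (f s)) =
        u (D.outSide true s) + u (D.outSide false s) := by
    intro u hu s
    rw [← D.inSide_next true s, ← D.inSide_next false s]
    have hx := congrFun (LinearMap.mem_ker.1 hu) (D.next s).1
    rw [Matrix.mulVecLin_apply, cornerMatrix_mulVec] at hx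
    have hfs : f s = ((D.next s).1, !(D.next s).2) := rfl
    rw [hfs]
    generalize D.next s = t at *
    obtain ⟨y, b⟩ := t
    simp only [Pi.zero_apply] at hx
    rw [← CharTwo.add_eq_zero, ← hx]
    cases b <;> simp [outSide, inSide, lateral] <;> ring
  let Ψ : LinearMap.ker D.cornerMatrix.mulVecLin →ₗ[ZMod 2] (Comp → ZMod 2) × ZMod 2 :=
    { toFun := fun u => (fun C => u.1 (D.outSide true C.out) + u.1 (D.outSide false C.out),
        u.1 (D.north x₀))
      map_add' := by
        intro u v
        exact Prod.ext (funext fun C => by simp; ring) (by simp)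
      map_smul' := by
        intro a u
        exact Prod.ext (funext fun C => by simp; ring) (by simp) }
  have hΨ : Function.Injective Ψ := by
    rw [← LinearMap.ker_eq_bot, LinearMap.ker_eq_bot']
    rintro ⟨u, hu⟩ h0
    have h1 : ∀ C : Comp, u (D.outSide true C.out) + u (D.outSide false C.out) = 0 :=
      fun C => congrFun (congrArg Prod.fst h0) C
    have h2 : u (D.north x₀) = 0 := congrArg Prod.snd h0
    have h3 : ∀ s, u (D.outSide true s) = u (D.outSide false s) := by
      intro s
      rw [← CharTwo.add_eq_zero, ← apply_eq_of_sameCycle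
        (g := fun t => u (D.outSide true t) + u (D.outSide false t)) (hinv u hu)
        (Quotient.exact (Quotient.out_eq (Quotient.mk (Equiv.Perm.SameCycle.setoid f) s)))]
      exact h1 _
    have he : ∀ x, u (D.east x) = u (D.north x) := by
      intro x
      simpa [outSide, lateral] using (h3 (x, true)).symm
    have hw : ∀ x, u (D.west x) = u (D.north x) := by
      intro x
      simpa [outSide, lateral] using h3 (x, false)
    have hs : ∀ x, u (D.south x) = u (D.north x) := by
      intro x
      have hx := congrFun (LinearMap.mem_ker.1 hu) x
      rw [Matrix.mulVecLin_apply, cornerMatrix_mulVec, he, hw, Pi.zero_apply] at hx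
      have key : ∀ a b : ZMod 2, b + a + b + b = 0 → a = b := by decide
      exact key _ _ hx
    ext r
    exact (D.eq_of_forall_corner hD hs he hw r (D.north x₀)).trans h2
  have h := LinearMap.finrank_le_finrank_of_injective hΨ
  rw [Module.finrank_prod, finrank_invariant_eq_numCycles, Module.finrank_self] at h
  exact h

/-- A function on the regions without jumps across crossings is constant on either side of each Seifert
circle, hence determined, up to a constant, by its jumps across the Seifert circles. -/
theorem finrank_ker_coboundary_le (hD : D.shadow.Connected) :
    Module.finrank (ZMod 2) (LinearMap.ker D.coboundary) ≤ D.numSeifertCircles + 1 := by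
  obtain ⟨x₀⟩ := hD.nonempty
  have hns : ∀ u ∈ LinearMap.ker D.coboundary, ∀ x, u (D.south x) = u (D.north x) := by
    intro u hu x
    exact (CharTwo.add_eq_zero.1 (congrFun (LinearMap.mem_ker.1 hu) x)).symm
  have hinv : ∀ u ∈ LinearMap.ker D.coboundary, ∀ b s,
      u (D.outSide b (D.next s)) = u (D.outSide b s) := by
    intro u hu b s
    rw [← D.inSide_next b s]
    unfold outSide inSide
    split_ifs
    · exact (hns u hu _).symm
    · rfl
  let Ψ : LinearMap.ker D.coboundary →ₗ[ZMod 2] (D.SeifertCircle → ZMod 2) × ZMod 2 :=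
    { toFun := fun u => (fun C => u.1 (D.outSide true C.out) + u.1 (D.outSide false C.out),
        u.1 (D.north x₀))
      map_add' := by
        intro u v
        exact Prod.ext (funext fun C => by simp; ring) (by simp)
      map_smul' := by
        intro a u
        exact Prod.ext (funext fun C => by simp; ring) (by simp) }
  have hΨ : Function.Injective Ψ := by
    rw [← LinearMap.ker_eq_bot, LinearMap.ker_eq_bot']
    rintro ⟨u, hu⟩ h0
    have h1 : ∀ C : D.SeifertCircle, u (D.outSide true C.out) + u (D.outSide false C.out) = 0 :=
      fun C => congrFun (congrArg Prod.fst h0) C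
    have h2 : u (D.north x₀) = 0 := congrArg Prod.snd h0
    have h3 : ∀ s, u (D.outSide true s) = u (D.outSide false s) := by
      intro s
      have h : ∀ b, u (D.outSide b (D.circle s).out) = u (D.outSide b s) := fun b =>
        apply_eq_of_sameCycle (g := fun t => u (D.outSide b t)) (hinv u hu b)
          (Quotient.exact (Quotient.out_eq (D.circle s)))
      rw [← CharTwo.add_eq_zero, ← h true, ← h false]
      exact h1 _
    have he : ∀ x, u (D.east x) = u (D.north x) := by
      intro x
      simpa [outSide, lateral] using (h3 (x, true)).symm
    have hw : ∀ x, u (D.west x) = u (D.north x) := by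
      intro x
      simpa [outSide, lateral] using h3 (x, false)
    ext r
    exact (D.eq_of_forall_corner hD (hns u hu) he hw r (D.north x₀)).trans h2
  have h := LinearMap.finrank_le_finrank_of_injective hΨ
  rw [Module.finrank_prod, finrank_invariant_eq_numCycles, Module.finrank_self] at h
  exact h

/-- The number of link components is bounded below if finitely many conditions on a function on the
regions ensure that its coboundary is orthogonal to the corners of each region. -/
theorem crossingNumber_add_two_le (hD : D.shadow.Connected)
    (hp : Nat.card D.Region = Nat.card X + 2) (Z : Finset X)
    (hZ : ∀ u, (∀ x ∈ Z, D.coboundary u x = 0) →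
      D.cornerMatrix.transpose.mulVec (D.coboundary u) = 0) :
    D.crossingNumber + 2 ≤ D.numComponents + D.numSeifertCircles + Z.card := by
  have h1 := D.finrank_ker_cornerMatrix_le hD
  have h2 := D.finrank_ker_coboundary_le hD
  have h3 := LinearMap.finrank_range_add_finrank_ker D.cornerMatrix.mulVecLin
  have h4 := LinearMap.finrank_range_add_finrank_ker D.cornerMatrix.transpose.mulVecLin
  have h5 : Module.finrank (ZMod 2) (LinearMap.range D.cornerMatrix.transpose.mulVecLin) =
      Module.finrank (ZMod 2) (LinearMap.range D.cornerMatrix.mulVecLin) :=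
    Matrix.rank_transpose D.cornerMatrix
  -- `ρ` evaluates the conditions, so that `LinearMap.ker ρ` is the space of functions meeting them
  let ρ : (D.Region → ZMod 2) →ₗ[ZMod 2] (Z → ZMod 2) :=
    (LinearMap.funLeft (ZMod 2) (ZMod 2) (fun z : Z => z.1)).comp D.coboundary
  have h6 := LinearMap.finrank_range_add_finrank_ker ρ
  have h7 : Module.finrank (ZMod 2) (LinearMap.range ρ) ≤ Z.card := by
    refine (Submodule.finrank_le _).trans ?_
    simp [Module.finrank_fintype_fun_eq_card]
  let δ := D.coboundary.domRestrict (LinearMap.ker ρ)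
  have h8 := LinearMap.finrank_range_add_finrank_ker δ
  have h9 : Module.finrank (ZMod 2) (LinearMap.range δ) ≤
      Module.finrank (ZMod 2) (LinearMap.ker D.cornerMatrix.transpose.mulVecLin) := by
    refine Submodule.finrank_mono ?_
    rintro _ ⟨⟨u, hu⟩, rfl⟩
    rw [LinearMap.mem_ker, Matrix.mulVecLin_apply]
    refine hZ u fun x hx => ?_
    exact congrFun (LinearMap.mem_ker.1 hu) ⟨x, hx⟩
  have h10 : Module.finrank (ZMod 2) (LinearMap.ker δ) ≤
      Module.finrank (ZMod 2) (LinearMap.ker D.coboundary) := by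
    let ι : LinearMap.ker δ →ₗ[ZMod 2] LinearMap.ker D.coboundary :=
      LinearMap.codRestrict _ ((Submodule.subtype _).comp (Submodule.subtype _)) fun u => u.2
    refine LinearMap.finrank_le_finrank_of_injective (f := ι) fun u v huv => ?_
    have h : (u.1.1 : D.Region → ZMod 2) = v.1.1 := congrArg (fun w => w.1) huv
    exact Subtype.ext (Subtype.ext h)
  rw [Module.finrank_fintype_fun_eq_card, ← Nat.card_eq_fintype_card] at h3 h4 h6
  unfold crossingNumber
  omega

end LinearAlgebra

/-! ### Equivalence classes of crossings -/

section Classes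

open scoped Classical

variable {X : Type*} [Fintype X] (D : DiagramCode X)

/-- The crossings with a given unordered pair of non-Seifert circle regions. -/
noncomputable def simClass (q : Sym2 D.Region) : Finset X :=
  Finset.univ.filter fun x => D.nonSeifertRegions x = q

theorem mem_simClass {q : Sym2 D.Region} {x : X} :
    x ∈ D.simClass q ↔ D.nonSeifertRegions x = q := by simp [simClass]

/-- The `∼`-classes, named by their pairs of non-Seifert circle regions. -/
noncomputable def simClasses : Finset (Sym2 D.Region) := Finset.univ.image D.nonSeifertRegions

theorem card_simClasses : D.simClasses.card = D.numSimClasses := by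
  rw [numSimClasses, simSetoid, Nat.card_congr (Setoid.quotientKerEquivRange D.nonSeifertRegions),
    Nat.card_eq_card_toFinset, Set.toFinset_range, simClasses]

theorem card_simClass_pos {q : Sym2 D.Region} (hq : q ∈ D.simClasses) :
    0 < (D.simClass q).card := by
  obtain ⟨x, -, rfl⟩ := Finset.mem_image.1 hq
  exact Finset.card_pos.2 ⟨x, D.mem_simClass.2 rfl⟩

theorem card_simClass_le (hirr : D.Irreducible) (q : Sym2 D.Region) :
    (D.simClass q).card ≤ 2 := by
  by_cases h : (D.simClass q).Nonempty
  · obtain ⟨x, hx⟩ := h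
    have h1 := hirr x
    rw [Nat.card_eq_fintype_card, Fintype.card_subtype] at h1
    refine le_trans (Finset.card_le_card fun y hy => ?_) h1
    rw [Finset.mem_filter]
    refine ⟨Finset.mem_univ _, ?_⟩
    exact (D.mem_simClass.1 hx).trans (D.mem_simClass.1 hy).symm
  · rw [Finset.not_nonempty_iff_eq_empty.1 h]
    simp

theorem sum_simClass {M : Type*} [AddCommMonoid M] (f : X → M) :
    ∑ q ∈ D.simClasses, ∑ x ∈ D.simClass q, f x = ∑ x, f x := by
  unfold simClass simClasses
  exact Finset.sum_fiberwise_of_maps_to (fun x hx => Finset.mem_image_of_mem _ hx) _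

theorem crossingNumber_eq_sum : D.crossingNumber = ∑ q ∈ D.simClasses, (D.simClass q).card := by
  have h := D.sum_simClass fun _ => 1
  simp only [Finset.sum_const, smul_eq_mul, mul_one, Finset.card_univ] at h
  rw [h, crossingNumber, Nat.card_eq_fintype_card]

theorem crossingNumber_le_two_mul (hirr : D.Irreducible) :
    D.crossingNumber ≤ 2 * D.numSimClasses := by
  rw [crossingNumber_eq_sum, ← card_simClasses, mul_comm, ← smul_eq_mul]
  exact Finset.sum_le_card_nsmul _ _ _ fun q _ => D.card_simClass_le hirr q

/-- The crossings which are not equivalent to any other crossing. -/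
noncomputable def singles : Finset X :=
  Finset.univ.filter fun x => (D.simClass (D.nonSeifertRegions x)).card = 1

/-- In characteristic two, the terms of a pair of equivalent crossings cancel. -/
theorem sum_eq_sum_singles (hirr : D.Irreducible) {M : Type*} [AddCommMonoid M]
    (h2 : ∀ m : M, m + m = 0) {f : X → M}
    (hf : ∀ x y, D.nonSeifertRegions x = D.nonSeifertRegions y → f x = f y) :
    ∑ x, f x = ∑ x ∈ D.singles, f x := by
  unfold singles
  rw [Finset.sum_filter, ← sum_simClass, ← sum_simClass]
  refine Finset.sum_congr rfl fun q hq => ?_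
  have hpos := D.card_simClass_pos hq
  have hle := D.card_simClass_le hirr q
  obtain ⟨x₀, hx₀⟩ := Finset.card_pos.1 hpos
  have h3 : ∀ x ∈ D.simClass q, f x = f x₀ := fun x hx =>
    hf _ _ ((D.mem_simClass.1 hx).trans (D.mem_simClass.1 hx₀).symm)
  rw [← Finset.sum_filter]
  obtain h | h : (D.simClass q).card = 1 ∨ (D.simClass q).card = 2 := by omega
  · rw [Finset.filter_true_of_mem]
    intro x hx
    rw [D.mem_simClass.1 hx, h]
  · rw [Finset.sum_congr rfl h3, Finset.sum_const, h, two_nsmul, h2,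
      Finset.filter_false_of_mem, Finset.sum_empty]
    intro x hx
    rw [D.mem_simClass.1 hx, h]
    norm_num

/-- A crossing which alone is attached to one side of a Seifert circle is nugatory. -/
theorem card_side_ne_one (hred : D.Reduced) (C : D.SeifertCircle) (b : Bool) :
    (D.side C b).card ≠ 1 := by
  intro h
  obtain ⟨x, hx⟩ := Finset.card_eq_one.1 h
  have h1 := D.sum_side_north (fun r => (Pi.single r 1 : D.Region → ℤ)) C b
  rw [hx, Finset.sum_singleton, Finset.sum_singleton] at h1
  have h2 := congrFun h1 (D.north x)
  rw [Pi.single_eq_same] at h2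
  refine hred x (Or.inl ?_)
  by_contra hne
  rw [Pi.single_eq_of_ne hne] at h2
  exact one_ne_zero h2

theorem two_le_card_side (hred : D.Reduced) {C : D.SeifertCircle} {b : Bool}
    (h : (D.side C b).Nonempty) : 2 ≤ (D.side C b).card := by
  have h1 := D.card_side_ne_one hred C b
  have h2 := Finset.card_pos.2 h
  omega

/-- Two crossings which alone are attached to one side of a Seifert circle are equivalent. -/
theorem nonSeifertRegions_eq_of_card_side_eq_two (hred : D.Reduced) {C : D.SeifertCircle} {b : Bool}
    (h : (D.side C b).card = 2) {x y : X} (hx : x ∈ D.side C b) (hy : y ∈ D.side C b) :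
    D.nonSeifertRegions x = D.nonSeifertRegions y := by
  by_cases hxy : x = y
  · rw [hxy]
  have hs : D.side C b = {x, y} := by
    symm
    refine Finset.eq_of_subset_of_card_le ?_ ?_
    · intro z hz
      rcases Finset.mem_insert.1 hz with rfl | hz
      · exact hx
      · rwa [Finset.mem_singleton.1 hz]
    · rw [h, Finset.card_pair hxy]
  have h1 := D.sum_side_north (fun r => (Pi.single r 1 : D.Region → ℤ)) C b
  rw [hs, Finset.sum_pair hxy, Finset.sum_pair hxy] at h1
  have hx' : D.north x ≠ D.south x := fun e => hred x (Or.inl e)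
  have hy' : D.north y ≠ D.south y := fun e => hred y (Or.inl e)
  have e1 : D.north x = D.south y := by
    by_contra hne
    have h2 := congrFun h1 (D.north x)
    simp only [Pi.add_apply, Pi.single_eq_same, Pi.single_eq_of_ne hne, Pi.single_eq_of_ne hx',
      Pi.single_apply] at h2
    split_ifs at h2 <;> omega
  have e2 : D.north y = D.south x := by
    by_contra hne
    have h2 := congrFun h1 (D.north y)
    simp only [Pi.add_apply, Pi.single_eq_same, Pi.single_eq_of_ne hne, Pi.single_eq_of_ne hy',
      Pi.single_apply] at h2
    split_ifs at h2 <;> omega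
  rw [nonSeifertRegions, nonSeifertRegions, e1, e2, Sym2.eq_swap]

theorem sum_coboundary_side (u : D.Region → ZMod 2) (C : D.SeifertCircle) (b : Bool) :
    ∑ x ∈ D.side C b, D.coboundary u x = 0 := by
  simp only [coboundary_apply]
  rw [Finset.sum_add_distrib, D.sum_side_north u C b, CharTwo.add_self_eq_zero]

omit [Fintype X] in
theorem coboundary_eq_of_nonSeifertRegions_eq (u : D.Region → ZMod 2) {x y : X}
    (h : D.nonSeifertRegions x = D.nonSeifertRegions y) :
    D.coboundary u x = D.coboundary u y := by
  rw [nonSeifertRegions, nonSeifertRegions, Sym2.eq_iff] at h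
  rw [coboundary_apply, coboundary_apply]
  rcases h with ⟨h1, h2⟩ | ⟨h1, h2⟩
  · rw [h1, h2]
  · rw [h1, h2, add_comm]

theorem sum_coboundary_singles (hirr : D.Irreducible) (u : D.Region → ZMod 2) :
    ∑ x ∈ D.singles, D.coboundary u x = 0 := by
  rw [← D.sum_eq_sum_singles hirr CharTwo.add_self_eq_zero
    fun x y h => D.coboundary_eq_of_nonSeifertRegions_eq u h, ← D.sum_side true]
  exact Finset.sum_eq_zero fun C _ => D.sum_coboundary_side u C true

/-- A coboundary which vanishes at the single crossings and along the gluing circles is orthogonal to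
the corners of every region: northern and southern corners cancel in pairs of equivalent crossings,
and the lateral corners cancel along each Seifert circle. -/
theorem transpose_cornerMatrix_mulVec_coboundary (hirr : D.Irreducible) {u : D.Region → ZMod 2}
    (h1 : ∀ x ∈ D.singles, D.coboundary u x = 0)
    (h2 : ∀ C, D.Gluing C → ∀ b, ∀ x ∈ D.side C b, D.coboundary u x = 0) :
    D.cornerMatrix.transpose.mulVec (D.coboundary u) = 0 := by
  set A := D.coboundary u with hA
  let e : D.Region → D.Region → ZMod 2 := fun r => Pi.single r 1
  have hrow : ∀ x, A x • D.cornerMatrix x =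
      A x • (e (D.north x) + e (D.south x)) +
        (A x • e (D.lateral (x, true)) + A x • e (D.lateral (x, false))) := by
    intro x
    rw [← smul_add, ← smul_add]
    congr 1
    change e _ + e _ + e _ + e _ = _
    simp only [lateral, if_true, Bool.false_eq_true, if_false]
    abel
  have hns : ∑ x, A x • (e (D.north x) + e (D.south x)) = 0 := by
    rw [D.sum_eq_sum_singles hirr]
    · exact Finset.sum_eq_zero fun x hx => by rw [h1 x hx, zero_smul]
    · intro m
      ext r
      exact CharTwo.add_self_eq_zero _
    · intro x y hxy
      rw [hA, D.coboundary_eq_of_nonSeifertRegions_eq u hxy]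
      congr 1
      rw [nonSeifertRegions, nonSeifertRegions, Sym2.eq_iff] at hxy
      rcases hxy with ⟨e1, e2⟩ | ⟨e1, e2⟩
      · rw [e1, e2]
      · rw [e1, e2, add_comm]
  have hlat : ∀ C b, ∑ x ∈ D.side C b, A x • e (D.lateral (x, b)) = 0 := by
    intro C b
    by_cases hg : D.Gluing C
    · exact Finset.sum_eq_zero fun x hx => by rw [h2 C hg b x hx, zero_smul]
    obtain hne | ⟨x₀, hx₀⟩ := (D.side C b).eq_empty_or_nonempty
    · rw [hne, Finset.sum_empty]
    have hemp : D.side C (!b) = ∅ := by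
      by_contra hne
      refine hg fun b' => ?_
      by_cases hb : b' = b
      · rw [hb]; exact ⟨x₀, hx₀⟩
      · have : b' = !b := by cases b <;> cases b' <;> simp_all
        rw [this]; exact Finset.nonempty_iff_ne_empty.2 hne
    have h3 : ∀ x ∈ D.side C b, A x • e (D.lateral (x, b)) = A x • e (D.lateral (x₀, b)) :=
      fun x hx => by
        rw [D.lateral_eq_of_side_eq_empty hemp (D.mem_side.1 hx) (D.mem_side.1 hx₀)]
    rw [Finset.sum_congr rfl h3, ← Finset.sum_smul, D.sum_coboundary_side, zero_smul]
  rw [Matrix.mulVec_transpose, Matrix.vecMul_eq_sum, Finset.sum_congr rfl fun x _ => hrow x,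
    Finset.sum_add_distrib, hns, Finset.sum_add_distrib, ← D.sum_side true, ← D.sum_side false]
  simp only [hlat, Finset.sum_const_zero, add_zero]

omit [Fintype X] in
theorem eq_zero_of_sum_eq_zero {s : Finset X} {f : X → ZMod 2} {x₀ : X}
    (h : ∑ x ∈ s, f x = 0) (h0 : ∀ x ∈ s.erase x₀, f x = 0) : ∀ x ∈ s, f x = 0 := by
  intro x hx
  by_cases hxx : x = x₀
  · subst hxx
    rwa [← Finset.add_sum_erase s f hx, Finset.sum_eq_zero h0, add_zero] at h
  · exact h0 x (Finset.mem_erase.2 ⟨hxx, hx⟩)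

omit [Fintype X] in
theorem exists_card_erase_eq [Nonempty X] (s : Finset X) : ∃ x, (s.erase x).card = s.card - 1 := by
  obtain rfl | ⟨x, hx⟩ := s.eq_empty_or_nonempty
  · exact ⟨Classical.arbitrary X, by simp⟩
  · exact ⟨x, Finset.card_erase_of_mem hx⟩

/-- The sides of the gluing circles, a side being a circle together with `true` (left) or `false`
(right). -/
noncomputable def gluingSides : Finset (D.SeifertCircle × Bool) :=
  Finset.univ.filter fun σ => D.Gluing σ.1

theorem mem_gluingSides {σ : D.SeifertCircle × Bool} : σ ∈ D.gluingSides ↔ D.Gluing σ.1 := by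
  simp [gluingSides]

/-- The lower bound for the number of components of an irreducible diagram.  The conditions on the
coboundary along one side of a circle, as well as those at the single crossings, add up to zero, so
that one of them can be spared each time. -/
theorem crossingNumber_add_two_le_of_irreducible (hD : D.shadow.Connected)
    (hp : Nat.card D.Region = Nat.card X + 2) (hirr : D.Irreducible) :
    D.crossingNumber + 2 ≤ D.numComponents + D.numSeifertCircles +
      ((∑ σ ∈ D.gluingSides, ((D.side σ.1 σ.2).card - 1)) + (D.singles.card - 1)) := by
  have := hD.nonempty
  choose p hpc using fun σ : D.SeifertCircle × Bool => exists_card_erase_eq (D.side σ.1 σ.2)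
  obtain ⟨p₁, hp₁⟩ := exists_card_erase_eq D.singles
  refine (D.crossingNumber_add_two_le hD hp
    (D.gluingSides.biUnion (fun σ => (D.side σ.1 σ.2).erase (p σ)) ∪ D.singles.erase p₁)
    fun u hu => D.transpose_cornerMatrix_mulVec_coboundary hirr ?_ ?_).trans ?_
  · refine eq_zero_of_sum_eq_zero (x₀ := p₁) (D.sum_coboundary_singles hirr u) fun x hx => ?_
    exact hu x (Finset.mem_union_right _ hx)
  · intro C hC b
    refine eq_zero_of_sum_eq_zero (x₀ := p (C, b)) (D.sum_coboundary_side u C b) fun x hx => ?_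
    exact hu x (Finset.mem_union_left _
      (Finset.mem_biUnion.2 ⟨(C, b), D.mem_gluingSides.2 hC, hx⟩))
  · refine Nat.add_le_add_left ((Finset.card_union_le _ _).trans (Nat.add_le_add ?_ hp₁.le)) _
    exact Finset.card_biUnion_le.trans (Finset.sum_le_sum fun σ _ => (hpc σ).le)

end Classes

/-! ### Counting bigons -/

section Bounds

open scoped Classical

variable {X : Type*} [Fintype X] (D : DiagramCode X)

/-- The sides of Seifert circles to which exactly two crossings are attached. -/
noncomputable def bigonSides : Finset (D.SeifertCircle × Bool) :=
  Finset.univ.filter fun σ => (D.side σ.1 σ.2).card = 2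

theorem mem_bigonSides {σ : D.SeifertCircle × Bool} :
    σ ∈ D.bigonSides ↔ (D.side σ.1 σ.2).card = 2 := by simp [bigonSides]

/-- A `∼`-class is full if both attachments of each of its crossings are on bigon sides. -/
def Full (q : Sym2 D.Region) : Prop :=
  ∀ x, D.nonSeifertRegions x = q → ∀ b, (D.circle (x, b), b) ∈ D.bigonSides

/-- The number of attachments to bigon sides of the crossings in a `∼`-class. -/
noncomputable def bigonEnds (q : Sym2 D.Region) : ℕ :=
  ∑ x ∈ D.simClass q, ∑ b, if (D.circle (x, b), b) ∈ D.bigonSides then 1 else 0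

theorem sum_sides {M : Type*} [AddCommMonoid M] (f : X → Bool → M) :
    ∑ σ : D.SeifertCircle × Bool, ∑ x ∈ D.side σ.1 σ.2, f x σ.2 = ∑ x, ∑ b, f x b := by
  rw [Fintype.sum_prod_type, Finset.sum_comm, Finset.sum_comm (s := (Finset.univ : Finset X))]
  exact Finset.sum_congr rfl fun b _ => D.sum_side b fun x => f x b

theorem sum_card_side : ∑ σ : D.SeifertCircle × Bool, (D.side σ.1 σ.2).card =
    2 * D.crossingNumber := by
  have h := D.sum_sides fun _ _ => 1
  simp only [Finset.sum_const, smul_eq_mul, mul_one, Finset.card_univ, Fintype.card_bool] at h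
  rw [h, crossingNumber, Nat.card_eq_fintype_card, mul_comm]

theorem sum_bigonEnds : ∑ q ∈ D.simClasses, D.bigonEnds q = 2 * D.bigonSides.card := by
  unfold bigonEnds
  rw [sum_simClass, ← sum_sides, mul_comm, ← smul_eq_mul, ← Finset.sum_const]
  conv_rhs => rw [bigonSides, Finset.sum_filter]
  refine Finset.sum_congr rfl fun σ _ => ?_
  have h : ∀ x ∈ D.side σ.1 σ.2, (if (D.circle (x, σ.2), σ.2) ∈ D.bigonSides then 1 else 0)
      = if (D.side σ.1 σ.2).card = 2 then 1 else 0 := by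
    intro x hx
    rw [D.mem_side.1 hx]
    exact if_congr D.mem_bigonSides rfl rfl
  rw [Finset.sum_congr rfl h, Finset.sum_const]
  split_ifs with h2
  · rw [h2]; rfl
  · simp

/-- The two crossings at a bigon side are equivalent, so their attachments come in pairs. -/
theorem two_dvd_bigonEnds (hred : D.Reduced) (q : Sym2 D.Region) : 2 ∣ D.bigonEnds q := by
  have h : D.bigonEnds q = ∑ x, ∑ b, if D.nonSeifertRegions x = q then
      (if (D.circle (x, b), b) ∈ D.bigonSides then 1 else 0) else 0 := by
    unfold bigonEnds simClass
    rw [Finset.sum_filter]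
    refine Finset.sum_congr rfl fun x _ => ?_
    split_ifs <;> simp
  rw [h, ← sum_sides]
  refine Finset.dvd_sum fun σ _ => ?_
  by_cases h2 : (D.side σ.1 σ.2).card = 2
  · obtain ⟨x₀, hx₀⟩ := Finset.card_pos.1 (by omega : 0 < (D.side σ.1 σ.2).card)
    rw [Finset.sum_congr rfl (g := fun _ => if D.nonSeifertRegions x₀ = q then 1 else 0),
      Finset.sum_const, h2]
    · exact Dvd.intro _ rfl
    · intro x hx
      rw [D.mem_side.1 hx, if_pos (D.mem_bigonSides.2 h2),
        D.nonSeifertRegions_eq_of_card_side_eq_two hred h2 hx hx₀]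
  · rw [Finset.sum_eq_zero]
    · exact dvd_zero 2
    · intro x hx
      rw [D.mem_side.1 hx, if_neg (fun hm => h2 (D.mem_bigonSides.1 hm)), ite_self]

/-- In a class that is not full, some attachment is not at a bigon, and then by parity at least two. -/
theorem bigonEnds_add_two_le (hred : D.Reduced) {q : Sym2 D.Region} (hq : q ∈ D.simClasses) :
    D.bigonEnds q + 2 ≤ 2 * (D.simClass q).card + if D.Full q then 2 else 0 := by
  have hterm : ∀ x, (∑ b, if (D.circle (x, b), b) ∈ D.bigonSides then 1 else 0) ≤ 2 := by
    intro x
    rw [Fintype.sum_bool]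
    split_ifs <;> norm_num
  have hpos := D.card_simClass_pos hq
  have hdvd := D.two_dvd_bigonEnds hred q
  have hle : D.bigonEnds q ≤ 2 * (D.simClass q).card := by
    rw [mul_comm, ← smul_eq_mul]
    exact Finset.sum_le_card_nsmul _ _ _ fun x _ => hterm x
  split_ifs with hf
  · omega
  · have hlt : D.bigonEnds q < 2 * (D.simClass q).card := by
      unfold Full at hf
      push Not at hf
      obtain ⟨x, hx, b, hb⟩ := hf
      rw [mul_comm, ← smul_eq_mul, ← Finset.sum_const]
      refine Finset.sum_lt_sum (fun x _ => hterm x) ⟨x, D.mem_simClass.2 hx, ?_⟩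
      rw [Fintype.sum_bool]
      cases b <;> rw [if_neg hb] <;> split_ifs <;> norm_num
    omega

/-- The full `∼`-classes. -/
noncomputable def fullClasses : Finset (Sym2 D.Region) := D.simClasses.filter D.Full

theorem sum_ite_full :
    (∑ q ∈ D.simClasses, if D.Full q then 2 else 0) = 2 * D.fullClasses.card := by
  rw [fullClasses, mul_comm, ← smul_eq_mul, ← Finset.sum_const, Finset.sum_filter]

theorem numSimClasses_add_card_bigonSides_le (hred : D.Reduced) :
    D.numSimClasses + D.bigonSides.card ≤ D.crossingNumber + D.fullClasses.card := by
  have h := Finset.sum_le_sum fun q hq => D.bigonEnds_add_two_le hred (q := q) hq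
  rw [Finset.sum_add_distrib, sum_bigonEnds, Finset.sum_const, smul_eq_mul, card_simClasses,
    Finset.sum_add_distrib, ← Finset.mul_sum, ← crossingNumber_eq_sum, sum_ite_full] at h
  omega

theorem card_singles : D.singles.card =
    ∑ q ∈ D.simClasses, if (D.simClass q).card = 1 then 1 else 0 := by
  rw [singles, Finset.card_filter, ← sum_simClass]
  refine Finset.sum_congr rfl fun q _ => ?_
  have h : ∀ x ∈ D.simClass q, (if (D.simClass (D.nonSeifertRegions x)).card = 1 then 1 else 0) =
      if (D.simClass q).card = 1 then 1 else 0 := fun x hx => by rw [D.mem_simClass.1 hx]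
  rw [Finset.sum_congr rfl h, Finset.sum_const]
  split_ifs with h1
  · rw [h1]; rfl
  · simp

/-- In an irreducible diagram, only the full classes can have more attachments to bigon sides than
crossings, and a single crossing has none unless its class is full. -/
theorem two_mul_card_bigonSides_add_card_singles_le (hred : D.Reduced) (hirr : D.Irreducible) :
    2 * D.bigonSides.card + D.singles.card ≤ D.crossingNumber + 2 * D.fullClasses.card := by
  have h : ∀ q ∈ D.simClasses, D.bigonEnds q + (if (D.simClass q).card = 1 then 1 else 0) ≤
      (D.simClass q).card + if D.Full q then 2 else 0 := by
    intro q hq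
    have h1 := D.bigonEnds_add_two_le hred hq
    have h2 := D.card_simClass_le hirr q
    split_ifs at h1 ⊢ <;> omega
  have h := Finset.sum_le_sum h
  rw [Finset.sum_add_distrib, sum_bigonEnds, ← card_singles,
    Finset.sum_add_distrib, ← crossingNumber_eq_sum, sum_ite_full] at h
  omega

theorem exists_side_nonempty (C : D.SeifertCircle) : ∃ b, (D.side C b).Nonempty := by
  obtain ⟨⟨x, b⟩, rfl⟩ := D.exists_circle_eq C
  exact ⟨b, x, D.mem_side.2 rfl⟩

theorem card_seifertCircle : Fintype.card D.SeifertCircle = D.numSeifertCircles := by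
  rw [numSeifertCircles, numCycles, Nat.card_eq_fintype_card]

/-- Each attachment of a crossing to a side of a Seifert circle gets the weight two, or three if the
side is a bigon.  Then every non-empty side weighs at least six; the excess over half of this can be
spent on the gluing circles, which have two non-empty sides. -/
theorem six_mul_numSeifertCircles_add_sum_le (hred : D.Reduced) {f : D.SeifertCircle × Bool → ℕ}
    (hf : ∀ σ ∈ D.gluingSides,
      f σ + 3 ≤ 2 * (D.side σ.1 σ.2).card + if σ ∈ D.bigonSides then 2 else 0) :
    6 * D.numSeifertCircles + ∑ σ ∈ D.gluingSides, f σ ≤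
      4 * D.crossingNumber + 2 * D.bigonSides.card := by
  have h1 : 4 * D.crossingNumber + 2 * D.bigonSides.card = ∑ C, ∑ b,
      (2 * (D.side C b).card + if (C, b) ∈ D.bigonSides then 2 else 0) := by
    rw [← Fintype.sum_prod_type' (f := fun C b =>
      2 * (D.side C b).card + if (C, b) ∈ D.bigonSides then 2 else 0), Finset.sum_add_distrib,
      ← Finset.mul_sum, sum_card_side, ← Finset.sum_filter, Finset.sum_const, smul_eq_mul]
    simp only [Prod.mk.eta, Finset.filter_mem_eq_inter, Finset.univ_inter]
    ring
  have h2 : ∑ σ ∈ D.gluingSides, f σ = ∑ C, if D.Gluing C then ∑ b, f (C, b) else 0 := by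
    rw [gluingSides, Finset.sum_filter, Fintype.sum_prod_type]
    refine Finset.sum_congr rfl fun C _ => ?_
    split_ifs <;> simp
  rw [h1, h2, ← card_seifertCircle, mul_comm, ← smul_eq_mul, ← Finset.card_univ,
    ← Finset.sum_const, ← Finset.sum_add_distrib]
  refine Finset.sum_le_sum fun C _ => ?_
  split_ifs with hg
  · have ht := hf (C, true) (D.mem_gluingSides.2 hg)
    have hf := hf (C, false) (D.mem_gluingSides.2 hg)
    dsimp only at ht hf
    rw [Fintype.sum_bool, Fintype.sum_bool]
    omega
  · obtain ⟨b, hb⟩ := D.exists_side_nonempty C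
    have h3 := D.two_le_card_side hred hb
    have h4 : 6 ≤ 2 * (D.side C b).card + if (C, b) ∈ D.bigonSides then 2 else 0 := by
      split_ifs with h5
      · omega
      · rw [mem_bigonSides] at h5
        simp only at h5
        omega
    exact h4.trans (Finset.single_le_sum (f := fun b =>
      2 * (D.side C b).card + if (C, b) ∈ D.bigonSides then 2 else 0)
      (fun b _ => Nat.zero_le _) (Finset.mem_univ b))

/-- The `∼`-class of some crossing at a side of a Seifert circle, and a junk value at an empty side.  It
is used for bigon sides only, where both crossings are equivalent. -/
noncomputable def sideClass [Nonempty X] (σ : D.SeifertCircle × Bool) : Sym2 D.Region :=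
  D.nonSeifertRegions (Classical.epsilon fun x => x ∈ D.side σ.1 σ.2)

theorem sideClass_eq [Nonempty X] (hred : D.Reduced) {σ : D.SeifertCircle × Bool}
    (hσ : σ ∈ D.bigonSides) {x : X} (hx : x ∈ D.side σ.1 σ.2) :
    D.sideClass σ = D.nonSeifertRegions x :=
  D.nonSeifertRegions_eq_of_card_side_eq_two hred (D.mem_bigonSides.1 hσ)
    (Classical.epsilon_spec (p := fun x => x ∈ D.side σ.1 σ.2) ⟨x, hx⟩) hx

/-- The gluing sides at which the crossings of some full class are attached. -/
noncomputable def fullGluingSides [Nonempty X] : Finset (D.SeifertCircle × Bool) :=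
  D.gluingSides.filter fun σ => σ ∈ D.bigonSides ∧ D.Full (D.sideClass σ)

/-- If an edge joins two crossings attached to its Seifert circle from the same side, and the first
one lies in a full class, then these two are all the crossings on that side, hence equivalent. -/
theorem nonSeifertRegions_next (hred : D.Reduced) {x : X} (hf : D.Full (D.nonSeifertRegions x))
    (b : Bool) (hb : (D.next (x, b)).2 = b) :
    D.nonSeifertRegions (D.next (x, b)).1 = D.nonSeifertRegions x := by
  refine D.nonSeifertRegions_eq_of_card_side_eq_two hred (C := D.circle (x, b)) (b := b)
    (D.mem_bigonSides.1 (hf x rfl b)) ?_ (D.mem_side.2 rfl)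
  rw [mem_side, ← D.circle_next (x, b)]
  congr 1
  exact Prod.ext rfl hb.symm

/-- An edge joining crossings attached from different sides belongs to a gluing circle. -/
theorem gluing_of_next {x : X} {b : Bool} (hb : (D.next (x, b)).2 ≠ b) :
    D.Gluing (D.circle (x, b)) := by
  intro b'
  by_cases hb' : b' = b
  · exact ⟨x, D.mem_side.2 (by rw [hb'])⟩
  · refine ⟨(D.next (x, b)).1, ?_⟩
    rw [mem_side, ← D.circle_next (x, b)]
    congr 1
    refine Prod.ext rfl ?_
    generalize (D.next (x, b)).2 = b'' at *
    cases b <;> cases b' <;> cases b'' <;> simp_all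

/-- A full class with no crossing on a gluing circle is the whole diagram, and then the diagram is
the closure of an antiparallel two-strand twist. -/
theorem exists_gluing_or_isolated (hD : D.shadow.Connected) (hred : D.Reduced)
    {q : Sym2 D.Region} (hq : q ∈ D.fullClasses) :
    (∃ x b, D.nonSeifertRegions x = q ∧ D.Gluing (D.circle (x, b))) ∨
      (D.numSimClasses = 1 ∧ D.eulerChar = 0) := by
  obtain ⟨hq, hf⟩ := Finset.mem_filter.1 hq
  by_cases hg : ∃ x b, D.nonSeifertRegions x = q ∧ D.Gluing (D.circle (x, b))
  · exact Or.inl hg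
  push Not at hg
  obtain ⟨x₀, -, hx₀⟩ := Finset.mem_image.1 hq
  have hall : ∀ x, D.nonSeifertRegions x = q := by
    refine D.forall_of_closed hD (P := fun x => D.nonSeifertRegions x = q) ?_ hx₀
    intro x b hx
    refine (D.nonSeifertRegions_next hred (by rwa [hx]) b ?_).trans hx
    by_contra hb
    exact hg x b hx (D.gluing_of_next hb)
  right
  constructor
  · rw [← card_simClasses, Finset.card_eq_one]
    refine ⟨q, Finset.eq_singleton_iff_unique_mem.2 ⟨hq, fun q' hq' => ?_⟩⟩
    obtain ⟨x, -, rfl⟩ := Finset.mem_image.1 hq'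
    exact hall x
  · have h := D.sum_card_side
    have h2 : ∀ C, ∑ b, (D.side C b).card = 2 := by
      intro C
      obtain ⟨⟨x, b⟩, rfl⟩ := D.exists_circle_eq C
      have hb := D.mem_bigonSides.1 (hf x (hall x) b)
      have hb' : D.side (D.circle (x, b)) (!b) = ∅ := by
        by_contra hne
        refine hg x b (hall x) fun b' => ?_
        by_cases hbb : b' = b
        · exact ⟨x, D.mem_side.2 (by rw [hbb])⟩
        · have : b' = !b := by cases b <;> cases b' <;> simp_all
          rw [this]; exact Finset.nonempty_iff_ne_empty.2 hne
      rw [Fintype.sum_bool]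
      cases b
      · simp only [Bool.not_false] at hb'
        rw [hb', Finset.card_empty, zero_add]; exact hb
      · simp only [Bool.not_true] at hb'
        rw [hb', Finset.card_empty, add_zero]; exact hb
    rw [Fintype.sum_prod_type, Finset.sum_congr rfl fun C _ => h2 C, Finset.sum_const,
      Finset.card_univ, card_seifertCircle, smul_eq_mul] at h
    unfold eulerChar
    omega

/-- Unless the diagram is a single twist, every full class is attached to a gluing circle. -/
theorem fullClasses_subset_image [Nonempty X] (hD : D.shadow.Connected) (hred : D.Reduced)
    (h : ¬ (D.numSimClasses = 1 ∧ D.eulerChar = 0)) :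
    D.fullClasses ⊆ D.fullGluingSides.image D.sideClass := by
  intro q hq
  obtain ⟨x, b, hx, hg⟩ := (D.exists_gluing_or_isolated hD hred hq).resolve_right h
  have hf := (Finset.mem_filter.1 hq).2
  have hb := hf x hx b
  have hs : D.sideClass (D.circle (x, b), b) = q :=
    (D.sideClass_eq hred hb (D.mem_side.2 rfl)).trans hx
  refine Finset.mem_image.2 ⟨(D.circle (x, b), b), ?_, hs⟩
  exact Finset.mem_filter.2 ⟨D.mem_gluingSides.2 hg, hb, by rwa [hs]⟩

theorem card_fullClasses_le [Nonempty X] (hD : D.shadow.Connected) (hred : D.Reduced)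
    (h : ¬ (D.numSimClasses = 1 ∧ D.eulerChar = 0)) :
    D.fullClasses.card ≤ D.fullGluingSides.card :=
  (Finset.card_le_card (D.fullClasses_subset_image hD hred h)).trans Finset.card_image_le

theorem card_fullGluingSides_le [Nonempty X] : D.fullGluingSides.card ≤ D.gluingSides.card :=
  Finset.card_filter_le _ _

/-- Give the weight three to each of the two sides of every gluing circle.  This pays for the full
classes, because each of them is attached to a gluing circle. -/
theorem numSimClasses_le (hD : D.shadow.Connected) (hred : D.Reduced) :
    (D.numSimClasses = 1 ∧ D.eulerChar = 0) ∨ (D.numSimClasses : ℤ) ≤ -3 * D.eulerChar := by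
  have := hD.nonempty
  by_cases h : D.numSimClasses = 1 ∧ D.eulerChar = 0
  · exact Or.inl h
  right
  have h1 := D.card_fullClasses_le hD hred h
  have h2 := D.card_fullGluingSides_le
  have h3 := D.numSimClasses_add_card_bigonSides_le hred
  have h4 := D.six_mul_numSeifertCircles_add_sum_le hred (f := fun _ => 3) (by
    intro σ hσ
    have h5 := D.two_le_card_side hred (D.mem_gluingSides.1 hσ σ.2)
    split_ifs with h6
    · omega
    · rw [mem_bigonSides] at h6
      omega)
  rw [Finset.sum_const, smul_eq_mul] at h4
  unfold eulerChar
  omega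

/-- If every gluing side belongs to a full class, and different gluing sides to different classes,
then only one Seifert circle is gluing and the diagram consists of the two classes attached to it. -/
theorem crossingNumber_le_four [Nonempty X] (hD : D.shadow.Connected) (hred : D.Reduced)
    (hirr : D.Irreducible) (hfull : D.fullGluingSides = D.gluingSides)
    (hinj : Set.InjOn D.sideClass D.gluingSides) {C : D.SeifertCircle} (hC : D.Gluing C) :
    D.crossingNumber ≤ 4 := by
  have hCb : ∀ b, (C, b) ∈ D.gluingSides := fun b => D.mem_gluingSides.2 hC
  have hCf : ∀ b, (C, b) ∈ D.bigonSides ∧ D.Full (D.sideClass (C, b)) := fun b =>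
    (Finset.mem_filter.1 (hfull.symm ▸ hCb b : (C, b) ∈ D.fullGluingSides)).2
  have hall : ∀ x, ∃ b, D.nonSeifertRegions x = D.sideClass (C, b) := by
    obtain ⟨x₀, hx₀⟩ := hC true
    refine D.forall_of_closed hD
      (P := fun x => ∃ b, D.nonSeifertRegions x = D.sideClass (C, b)) ?_
      ⟨true, (D.sideClass_eq hred (hCf true).1 hx₀).symm⟩
    rintro x b ⟨b₀, hx⟩
    have hf : D.Full (D.nonSeifertRegions x) := by rw [hx]; exact (hCf b₀).2
    by_cases hb : (D.next (x, b)).2 = b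
    · exact ⟨b₀, (D.nonSeifertRegions_next hred hf b hb).trans hx⟩
    · have hg := D.gluing_of_next hb
      have h1 : D.sideClass (D.circle (x, b), b) = D.sideClass (C, b₀) :=
        (D.sideClass_eq hred (hf x rfl b) (D.mem_side.2 rfl)).trans hx
      have h2 := hinj (D.mem_gluingSides.2 hg) (hCb b₀) h1
      obtain ⟨h3, -⟩ := Prod.mk.inj h2
      refine ⟨(D.next (x, b)).2, (D.sideClass_eq hred (hCf _).1 ?_).symm⟩
      rw [mem_side, Prod.mk.eta, circle_next, h3]
  have hsub : (Finset.univ : Finset X) ⊆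
      D.simClass (D.sideClass (C, true)) ∪ D.simClass (D.sideClass (C, false)) := by
    intro x _
    obtain ⟨b, hb⟩ := hall x
    rw [Finset.mem_union, mem_simClass, mem_simClass]
    cases b
    exacts [Or.inr hb, Or.inl hb]
  have h1 := (Finset.card_le_card hsub).trans (Finset.card_union_le _ _)
  have h2 := D.card_simClass_le hirr (D.sideClass (C, true))
  have h3 := D.card_simClass_le hirr (D.sideClass (C, false))
  rw [Finset.card_univ] at h1
  rw [crossingNumber, Nat.card_eq_fintype_card]
  omega

/-- The inequalities between crossings, bigons, full classes and single crossings combine to the bound,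
with something to spare unless there are no single crossings and each gluing side belongs to a full
class of its own.  The second alternative is a diagram without gluing circle and without single
crossings, the third one a diagram made of two full classes. -/
theorem crossingNumber_le (hD : D.shadow.Connected)
    (hp : Nat.card D.Region = Nat.card X + 2) (hred : D.Reduced) (hirr : D.Irreducible)
    (hχ : D.eulerChar < 0) :
    (D.crossingNumber : ℤ) ≤ -5 * D.eulerChar + D.numComponents - 3 ∨
      2 - D.eulerChar ≤ (D.numComponents : ℤ) ∨ D.crossingNumber ≤ 4 := by
  have := hD.nonempty
  have h : ¬ (D.numSimClasses = 1 ∧ D.eulerChar = 0) := fun h => hχ.ne h.2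
  have h1 := D.card_fullClasses_le hD hred h
  have h2 := D.card_fullGluingSides_le
  have h3 := D.two_mul_card_bigonSides_add_card_singles_le hred hirr
  have h4 := D.crossingNumber_add_two_le_of_irreducible hD hp hirr
  have h5 := D.six_mul_numSeifertCircles_add_sum_le hred
    -- the first summand pays for the bound on the number of components, the second one for the full
    -- classes and the final `+ 1`
    (f := fun σ => ((D.side σ.1 σ.2).card - 1) + (1 + if σ ∈ D.bigonSides then 1 else 0)) (by
      intro σ hσ
      have h5 := D.two_le_card_side hred (D.mem_gluingSides.1 hσ σ.2)
      split_ifs with h6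
      · omega
      · rw [mem_bigonSides] at h6
        omega)
  rw [Finset.sum_add_distrib, Finset.sum_add_distrib, Finset.sum_const, smul_eq_mul,
    ← Finset.sum_filter, Finset.sum_const, smul_eq_mul] at h5
  have h6 : D.fullGluingSides.card ≤ (D.gluingSides.filter (· ∈ D.bigonSides)).card := by
    refine Finset.card_le_card fun σ hσ => ?_
    obtain ⟨h7, h8, -⟩ := Finset.mem_filter.1 hσ
    exact Finset.mem_filter.2 ⟨h7, h8⟩
  by_cases hgap : D.singles.card = 0 ∧ D.fullClasses.card = D.gluingSides.card
  · obtain ⟨hs, ha⟩ := hgap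
    right
    obtain he | ⟨⟨C, b⟩, hC⟩ := D.gluingSides.eq_empty_or_nonempty
    · left
      rw [he, hs, Finset.sum_empty] at h4
      unfold eulerChar
      omega
    · right
      have hfull : D.fullGluingSides = D.gluingSides :=
        Finset.eq_of_subset_of_card_le (Finset.filter_subset _ _) (by omega)
      refine D.crossingNumber_le_four hD hred hirr hfull ?_ (D.mem_gluingSides.1 hC)
      rw [← hfull]
      refine Finset.card_image_iff.1 (le_antisymm Finset.card_image_le ?_)
      refine le_trans ?_ (Finset.card_le_card (D.fullClasses_subset_image hD hred h))
      omega
  · left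
    unfold eulerChar
    omega

theorem numComponents_pos [Nonempty X] : 0 < D.numComponents := by
  have : Nonempty (Quotient (Equiv.Perm.SameCycle.setoid
      (D.next.trans ((Equiv.refl X).prodCongr Equiv.boolNot)))) :=
    ⟨Quotient.mk _ (Classical.arbitrary X, true)⟩
  exact Nat.card_pos

end Bounds

end DiagramCode

/-- The upper bounds on the numbers of `∼`-classes and of crossings. -/
theorem ConnectedLinkDiagram.bounds {X : Type*} [Finite X] (D : ConnectedLinkDiagram X)
    (hred : D.Reduced) :
    (D.eulerChar < 0 → (D.numSimClasses : ℤ) ≤ -3 * D.eulerChar) ∧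
    (D.eulerChar = 0 → D.numSimClasses ≤ 1) ∧
    (D.Irreducible →
      (D.eulerChar = -1 → D.numComponents = 1 → D.crossingNumber ≤ 4) ∧
      (D.eulerChar = 0 → D.crossingNumber ≤ 2) ∧
      (D.eulerChar < 0 → (D.numComponents : ℤ) = 2 - D.eulerChar →
        (D.crossingNumber : ℤ) ≤ -6 * D.eulerChar) ∧
      (D.eulerChar < 0 → (D.numComponents : ℤ) ≠ 2 - D.eulerChar →
        ¬ (D.eulerChar = -1 ∧ D.numComponents = 1) →
        (D.crossingNumber : ℤ) ≤ -5 * D.eulerChar + D.numComponents - 3)) := by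
  have := Fintype.ofFinite X
  have := D.connected.nonempty
  have h1 := D.numSimClasses_le D.connected hred
  have hn := D.numComponents_pos
  refine ⟨fun h => by omega, fun h => by omega, fun hirr => ?_⟩
  have h2 := D.crossingNumber_le_two_mul hirr
  have h3 := D.crossingNumber_le D.connected D.planar hred hirr
  refine ⟨fun h h' => ?_, fun h => by omega, fun h h' => by omega, fun h h' h'' => ?_⟩
  · have := h3 (by omega)
    omega
  · have := h3 h
    omega

/-! ### Cycles of permutations -/

theorem Equiv.Perm.SameCycle.map_of_forall {α β : Type*} [Finite α] {f : Equiv.Perm α}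
    {g : Equiv.Perm β} {φ : α → β} (h : ∀ a, g.SameCycle (φ a) (φ (f a))) {a b : α}
    (hab : f.SameCycle a b) : g.SameCycle (φ a) (φ b) := by
  obtain ⟨n, -, rfl⟩ := hab.exists_pow_eq'
  induction n with
  | zero => rfl
  | succ n ih =>
    rw [pow_succ', Equiv.Perm.mul_apply]
    exact (ih ⟨n, by simp⟩).trans (h _)

theorem Equiv.Perm.sameCycle_self_apply {α : Type*} (f : Equiv.Perm α) (a : α) :
    f.SameCycle a (f a) :=
  Equiv.Perm.sameCycle_apply_right.2 (Equiv.Perm.SameCycle.refl f a)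

/-- The cycles of a permutation correspond to the values of an invariant function which separates
them. -/
theorem numCycles_eq_card {α L : Type*} [Finite α] (f : Equiv.Perm α) (l : α → L)
    (r : L → α) (hl : ∀ a, l (f a) = l a) (hr : ∀ i, l (r i) = i)
    (hs : ∀ a, f.SameCycle a (r (l a))) : numCycles f = Nat.card L := by
  refine Nat.card_congr ⟨Quotient.lift l fun a b h => DiagramCode.apply_eq_of_sameCycle hl h,
    fun i => Quotient.mk _ (r i), ?_, hr⟩
  intro C
  induction C using Quotient.inductionOn with
  | h a => exact (Quotient.sound (hs a)).symm

namespace DiagramCode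

/-! ### Special diagrams -/

section Special

variable {X : Type*}

/-- The special diagram whose Seifert circles are the cycles of `σ false`, with all crossings attached
from the right, and the cycles of `σ true`, with all crossings attached from the left.  All crossings
are positive, so that the diagram is alternating. -/
def special (σ : Bool → Equiv.Perm X) : DiagramCode X where
  next := Equiv.prodCongrLeft σ
  positive _ := true

variable (σ : Bool → Equiv.Perm X)

/-- The rotation of the crossings around the non-Seifert circle regions. -/
def vertexPerm : Equiv.Perm X := (σ true).trans (σ false).symm

/-- Two steps along a strand, starting at a western outgoing end. -/
def strandPerm : Equiv.Perm X := (σ false).trans (σ true)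

theorem special_next (x : X) (b : Bool) : (special σ).next (x, b) = (σ b x, b) := rfl

theorem special_facePerm_east (x : X) :
    (special σ).facePerm (Sum.inr (x, true)) = Sum.inr ((σ true).symm x, true) := rfl

theorem special_alternating : (special σ).Alternating := by
  rintro ⟨x, b⟩
  rw [special_next]
  simp [outOver, inOver, special]

theorem numSeifertCircles_special [Finite X] :
    (special σ).numSeifertCircles = numCycles (σ false) + numCycles (σ true) := by
  let Q (b : Bool) := Quotient (Equiv.Perm.SameCycle.setoid (σ b))
  have h := numCycles_eq_card (special σ).next
    (fun s => (⟨s.2, Quotient.mk _ s.1⟩ : Σ b, Q b)) (fun q => (q.2.out, q.1))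
    (fun s => by
      obtain ⟨x, b⟩ := s
      rw [special_next]
      exact congrArg (Sigma.mk b)
        (Quotient.sound ((σ b).sameCycle_self_apply x).symm))
    (fun q => by simp)
    (fun s => by
      obtain ⟨x, b⟩ := s
      refine Equiv.Perm.SameCycle.map_of_forall (f := σ b) (φ := fun y => (y, b)) (fun y => ?_)
        (Quotient.exact
          (Quotient.out_eq (Quotient.mk (Equiv.Perm.SameCycle.setoid (σ b)) x)).symm)
      exact (special σ).next.sameCycle_self_apply (y, b))
  rw [numSeifertCircles, h, Nat.card_sigma, Fintype.sum_bool, add_comm]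
  rfl

/-- The regions of a special diagram, given by the cycles of three permutations of the crossings. -/
theorem card_region_special [Finite X] : Nat.card (special σ).Region =
    numCycles (vertexPerm σ) + (numCycles (σ false) + numCycles (σ true)) := by
  let Q (f : Equiv.Perm X) := Quotient (Equiv.Perm.SameCycle.setoid f)
  let mk (f : Equiv.Perm X) (x : X) : Q f := Quotient.mk _ x
  have hmk : ∀ f : Equiv.Perm X, ∀ x, mk f (f x) = mk f x := fun f x =>
    Quotient.sound (f.sameCycle_self_apply x).symm
  have hmk' : ∀ f : Equiv.Perm X, ∀ x, mk f (f.symm x) = mk f x := fun f x => by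
    rw [← hmk f (f.symm x), Equiv.apply_symm_apply]
  have hout : ∀ f : Equiv.Perm X, ∀ x, f.SameCycle x (mk f x).out := fun f x =>
    Quotient.exact (Quotient.out_eq (mk f x)).symm
  let F := (special σ).facePerm
  have hF : ∀ d, F.SameCycle d (F d) := F.sameCycle_self_apply
  let l : Dart X → Q (vertexPerm σ) ⊕ (Q (σ false) ⊕ Q (σ true))
    | Sum.inl (x, true) => Sum.inl (mk _ x)
    | Sum.inl (x, false) => Sum.inr (Sum.inl (mk _ x))
    | Sum.inr (x, false) => Sum.inl (mk _ ((σ false).symm x))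
    | Sum.inr (x, true) => Sum.inr (Sum.inr (mk _ x))
  let r : Q (vertexPerm σ) ⊕ (Q (σ false) ⊕ Q (σ true)) → Dart X
    | Sum.inl q => Sum.inl (q.out, true)
    | Sum.inr (Sum.inl q) => Sum.inl (q.out, false)
    | Sum.inr (Sum.inr q) => Sum.inr (q.out, true)
  have hN : ∀ x, F.SameCycle (Sum.inl (x, true)) (Sum.inl ((mk (vertexPerm σ) x).out, true)) := by
    intro x
    refine Equiv.Perm.SameCycle.map_of_forall (φ := fun y => (Sum.inl (y, true) : Dart X))
      (fun y => ?_) (hout (vertexPerm σ) x)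
    exact (hF _).trans (hF _)
  have h := numCycles_eq_card F l r
    (by
      rintro (⟨x, _ | _⟩ | ⟨x, _ | _⟩)
      · exact congrArg (fun q => Sum.inr (Sum.inl q)) (hmk (σ false) x)
      · exact congrArg Sum.inl (hmk (vertexPerm σ) x)
      · rfl
      · exact congrArg (fun q => Sum.inr (Sum.inr q)) (hmk' (σ true) x))
    (by rintro (q | q | q) <;> simp [l, r, mk])
    (by
      rintro (⟨x, _ | _⟩ | ⟨x, _ | _⟩)
      · refine Equiv.Perm.SameCycle.map_of_forall (φ := fun y => (Sum.inl (y, false) : Dart X))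
          (fun y => ?_) (hout (σ false) x)
        exact hF _
      · exact hN x
      · exact (hF _).trans (hN _)
      · refine Equiv.Perm.SameCycle.map_of_forall (φ := fun y => (Sum.inr (y, true) : Dart X))
          (fun y => ?_) (hout (σ true) x)
        have h1 := hF (Sum.inr (σ true y, true))
        have h2 : F (Sum.inr (σ true y, true)) = Sum.inr (y, true) := by
          rw [special_facePerm_east, Equiv.symm_apply_apply]
        rw [h2] at h1
        exact h1.symm)
  have := Fintype.ofFinite X
  rw [Nat.card_sum, Nat.card_sum] at h
  exact h

/-- If the crossings form one cycle of `strandPerm`, the special diagram is a knot diagram. -/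
theorem numComponents_special [Finite X] {x₀ : X}
    (h : ∀ x, (strandPerm σ).SameCycle x x₀) : (special σ).numComponents = 1 := by
  let f : Equiv.Perm (X × Bool) :=
    (special σ).next.trans ((Equiv.refl X).prodCongr Equiv.boolNot)
  have hf : ∀ s, f.SameCycle s (f s) := f.sameCycle_self_apply
  have hstep : ∀ x, f.SameCycle (x, false) (strandPerm σ x, false) := fun x =>
    (hf (x, false)).trans (hf (f (x, false)))
  have hfalse : ∀ x, f.SameCycle (x, false) (x₀, false) := fun x =>
    Equiv.Perm.SameCycle.map_of_forall (φ := fun y => (y, false)) hstep (h x)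
  have hall : ∀ s, f.SameCycle s (x₀, false) := by
    rintro ⟨x, _ | _⟩
    · exact hfalse x
    · exact (hf (x, true)).trans (hfalse _)
  refine (numCycles_eq_card f (fun _ => ()) (fun _ => (x₀, false)) (fun _ => rfl)
    (fun _ => rfl) hall).trans ?_
  simp

theorem special_connected [Finite X] {x₀ : X}
    (h : ∀ x, (strandPerm σ).SameCycle x x₀) : (special σ).shadow.Connected := by
  have hadj : ∀ x b, (special σ).shadow.Reachable x (σ b x) := by
    intro x b
    by_cases hx : x = σ b x
    · rw [← hx]
    · refine SimpleGraph.Adj.reachable ?_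
      rw [shadow, SimpleGraph.fromRel_adj]
      exact ⟨hx, Or.inl ⟨b, b, rfl⟩⟩
  have hx₀ : ∀ x, (special σ).shadow.Reachable x x₀ := by
    intro x
    obtain ⟨n, -, hn⟩ := (h x).exists_pow_eq'
    rw [← hn]
    clear hn
    induction n with
    | zero => rfl
    | succ n ih =>
      rw [pow_succ', Equiv.Perm.mul_apply]
      exact ih.trans ((hadj _ false).trans (hadj _ true))
  have : Nonempty X := ⟨x₀⟩
  exact ⟨fun x y => (hx₀ x).trans (hx₀ y).symm⟩

theorem special_south (x : X) :
    (special σ).south x = (special σ).north ((σ false).symm x) :=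
  ((special σ).cornerRegion_facePerm (Sum.inr (x, false))).symm

theorem special_west_ne_east [Finite X] (x : X) : (special σ).west x ≠ (special σ).east x := by
  intro h
  let g : Dart X → ℕ
    | Sum.inl (_, true) => 0
    | Sum.inr (_, false) => 0
    | Sum.inl (_, false) => 1
    | Sum.inr (_, true) => 2
  have := apply_eq_of_sameCycle (g := g) (f := (special σ).facePerm)
    (by rintro (⟨x, _ | _⟩ | ⟨x, _ | _⟩) <;> rfl) (Quotient.exact h)
  simp [g] at this

/-- Functions on the crossings invariant under `vertexPerm` distinguish non-Seifert circle regions. -/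
theorem eq_of_special_north_eq [Finite X] {M : Type*} {v : X → M}
    (hv : ∀ x, v (vertexPerm σ x) = v x) {x y : X}
    (h : (special σ).north x = (special σ).north y) : v x = v y := by
  let g : Dart X → Option M
    | Sum.inl (x, true) => some (v x)
    | Sum.inr (x, false) => some (v ((σ false).symm x))
    | _ => none
  have := apply_eq_of_sameCycle (g := g) (f := (special σ).facePerm)
    (by
      rintro (⟨x, _ | _⟩ | ⟨x, _ | _⟩)
      · rfl
      · exact congrArg some (hv x)
      · rfl
      · rfl) (Quotient.exact h)
  exact Option.some.inj this

theorem special_reduced [Finite X] {M : Type*} {v : X → M}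
    (hv : ∀ x, v (vertexPerm σ x) = v x) (hne : ∀ x, v x ≠ v ((σ false).symm x)) :
    (special σ).Reduced := by
  rintro x (h | h)
  · rw [special_south] at h
    exact hne x (eq_of_special_north_eq σ hv h)
  · exact special_west_ne_east σ x h

theorem special_irreducible [Finite X] {M : Type*} {v : X → M}
    (hv : ∀ x, v (vertexPerm σ x) = v x) (p : X → X)
    (hp : ∀ x y, s(v x, v ((σ false).symm x)) = s(v y, v ((σ false).symm y)) → y = x ∨ y = p x) :
    (special σ).Irreducible := by
  classical
  intro x
  have := Fintype.ofFinite X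
  have hsub : {y | (special σ).simSetoid x y} ⊆ ((({x, p x} : Finset X)) : Set X) := by
    intro y hy
    have hy' : (special σ).nonSeifertRegions x = (special σ).nonSeifertRegions y := hy
    rw [nonSeifertRegions, nonSeifertRegions, special_south, special_south, Sym2.eq_iff] at hy'
    have h2 : y = x ∨ y = p x := by
      refine hp x y (Sym2.eq_iff.2 (hy'.imp ?_ ?_)) <;>
      · rintro ⟨h1, h2⟩
        exact ⟨eq_of_special_north_eq σ hv h1, eq_of_special_north_eq σ hv h2⟩
    simpa using h2
  have h1 := Nat.card_mono (Finset.finite_toSet _) hsub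
  refine h1.trans ?_
  rw [Nat.card_eq_card_toFinset, Finset.toFinset_coe]
  exact Finset.card_le_two

end Special

/-! ### The extremal knot diagrams -/

section Family

/-- The next crossing along the Seifert circle having the crossing `n` on its left, in the diagram of
`ConnectedLinkDiagram.family`.

Let `m = k + 2`.  The non-Seifert circle regions are the vertices of a polygon `q 0, …, q (m + 1)` on
the sphere, and the crossings are the edges of a graph on these vertices.  The edge from `q i` to
`q (i + 1)`, where indices are taken modulo `m + 2`, is simple and has the number `i`.  Inside the
polygon, `q 0` is joined to each of `q 2, …, q m` by two parallel edges, which have the numbers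
`k + 4, …, 2 * k + 4` and `2 * k + 5, …, 3 * k + 5`.  Outside, `q (m + 1)` is joined in the same way to
each of `q 1, …, q (m - 1)`, by edges with the numbers `3 * k + 6, …, 4 * k + 6` and
`4 * k + 7, …, 5 * k + 7`.  The Seifert circles correspond to the faces, which are triangles and bigons;
the circles with crossings on the left are the inner triangles and the outer bigons. -/
def leftStep (k n : ℕ) : ℕ :=
  if n = 0 then 1 else if n ≤ k + 1 then n + (k + 3) else if n = k + 2 then k + 3
  else if n = k + 3 then 3 * k + 5 else if n = k + 4 then 0 else if n ≤ 2 * k + 4 then n + k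
  else if n ≤ 3 * k + 5 then n - (2 * k + 3) else if n ≤ 4 * k + 6 then n + (k + 1)
  else n - (k + 1)

/-- The inverse of `leftStep`. -/
def leftBack (k n : ℕ) : ℕ :=
  if n = 0 then k + 4 else if n = 1 then 0 else if n ≤ k + 2 then n + (2 * k + 3)
  else if n = k + 3 then k + 2 else if n ≤ 2 * k + 4 then n - (k + 3)
  else if n ≤ 3 * k + 4 then n - k else if n = 3 * k + 5 then k + 3
  else if n ≤ 4 * k + 6 then n + (k + 1) else n - (k + 1)

/-- The next crossing along the Seifert circle having the crossing `n` on its right: an outer triangle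
or an inner bigon. -/
def rightStep (k n : ℕ) : ℕ :=
  if n ≤ k then n + (3 * k + 6) else if n = k + 1 then k + 2 else if n = k + 2 then 5 * k + 7
  else if n = k + 3 then 0 else if n ≤ 2 * k + 4 then n + (k + 1)
  else if n ≤ 3 * k + 5 then n - (k + 1) else if n = 3 * k + 6 then k + 3
  else if n ≤ 4 * k + 6 then n + k else n - (4 * k + 6)

/-- The inverse of `rightStep`. -/
def rightBack (k n : ℕ) : ℕ :=
  if n = 0 then k + 3 else if n ≤ k + 1 then n + (4 * k + 6) else if n = k + 2 then k + 1
  else if n = k + 3 then 3 * k + 6 else if n ≤ 2 * k + 4 then n + (k + 1)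
  else if n ≤ 3 * k + 5 then n - (k + 1) else if n ≤ 4 * k + 6 then n - (3 * k + 6)
  else if n ≤ 5 * k + 6 then n - k else k + 2

/-- The vertex at which the northern corner of the crossing `n` lies.  The vertex `q (i + 1)` has the
label `i`, and `q 0` has the label `k + 3`. -/
def vertexLabel (k n : ℕ) : ℕ :=
  if n ≤ k + 3 then n else if n ≤ 2 * k + 4 then k + 3 else if n ≤ 3 * k + 5 then n - (2 * k + 4)
  else if n ≤ 4 * k + 6 then k + 2 else n - (4 * k + 7)

variable {k n : ℕ}

theorem leftStep_lt (hn : n < 5 * k + 8) : leftStep k n < 5 * k + 8 := by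
  grind (splits := 20) [leftStep]

theorem leftBack_lt (hn : n < 5 * k + 8) : leftBack k n < 5 * k + 8 := by
  grind (splits := 20) [leftBack]

theorem rightStep_lt (hn : n < 5 * k + 8) : rightStep k n < 5 * k + 8 := by
  grind (splits := 20) [rightStep]

theorem rightBack_lt : rightBack k n < 5 * k + 8 := by
  grind (splits := 20) [rightBack]

theorem leftBack_leftStep (hn : n < 5 * k + 8) : leftBack k (leftStep k n) = n := by
  grind (splits := 20) [leftBack, leftStep]

theorem leftStep_leftBack (hn : n < 5 * k + 8) : leftStep k (leftBack k n) = n := by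
  grind (splits := 20) [leftStep, leftBack]

theorem rightBack_rightStep (hn : n < 5 * k + 8) : rightBack k (rightStep k n) = n := by
  grind (splits := 20) [rightBack, rightStep]

theorem rightStep_rightBack (hn : n < 5 * k + 8) : rightStep k (rightBack k n) = n := by
  grind (splits := 20) [rightStep, rightBack]

theorem vertexLabel_lt (hn : n < 5 * k + 8) : vertexLabel k n < k + 4 := by
  grind (splits := 20) [vertexLabel]

/-- The vertex at which the southern corner of the crossing `n` lies. -/
def oppositeLabel (k n : ℕ) : ℕ :=
  if n = 0 then k + 3 else if n ≤ k + 2 then n - 1 else if n = k + 3 then k + 2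
  else if n ≤ 2 * k + 4 then n - (k + 3) else if n ≤ 3 * k + 5 then k + 3
  else if n ≤ 4 * k + 6 then n - (3 * k + 6) else k + 2

theorem vertexLabel_rightBack (hn : n < 5 * k + 8) :
    vertexLabel k (rightBack k n) = oppositeLabel k n := by
  grind (splits := 20) [vertexLabel, rightBack, oppositeLabel]

theorem vertexLabel_ne (hn : n < 5 * k + 8) : vertexLabel k n ≠ oppositeLabel k n := by
  grind (splits := 20) [vertexLabel, oppositeLabel]

theorem oppositeLabel_leftStep (hn : n < 5 * k + 8) :
    oppositeLabel k (leftStep k n) = vertexLabel k n := by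
  grind (splits := 20) [vertexLabel, leftStep, oppositeLabel]

/-- The other edge with the same end points, if there is one. -/
def parallel (k n : ℕ) : ℕ :=
  if n ≤ k + 3 then n else if n ≤ 2 * k + 4 then n + (k + 1)
  else if n ≤ 3 * k + 5 then n - (k + 1) else if n ≤ 4 * k + 6 then n + (k + 1)
  else n - (k + 1)

theorem parallel_lt (hn : n < 5 * k + 8) : parallel k n < 5 * k + 8 := by
  grind (splits := 20) [parallel]

theorem eq_or_eq_parallel {l : ℕ} (hn : n < 5 * k + 8) (hl : l < 5 * k + 8)
    (h : vertexLabel k n = vertexLabel k l ∧ oppositeLabel k n = oppositeLabel k l ∨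
      vertexLabel k n = oppositeLabel k l ∧ oppositeLabel k n = vertexLabel k l) :
    l = n ∨ l = parallel k n := by
  grind (splits := 30) [vertexLabel, oppositeLabel, parallel]

/-- The crossing reached from the crossing `n` by two steps along a strand of the link. -/
def strandStep (k n : ℕ) : ℕ :=
  if n ≤ k then n + (4 * k + 7) else if n = k + 1 then k + 3 else if n = k + 2 then 4 * k + 6
  else if n = k + 3 then 1 else if n ≤ 2 * k + 4 then n - (k + 2)
  else if n = 2 * k + 5 then 0 else if n ≤ 4 * k + 6 then n - 1 else n - (3 * k + 3)

theorem leftStep_rightStep (hn : n < 5 * k + 8) :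
    leftStep k (rightStep k n) = strandStep k n := by
  grind (splits := 20) [leftStep, rightStep, strandStep]

/-- A numbering of the Seifert circles with crossings on the left, first the triangles. -/
def leftLabel (k n : ℕ) : ℕ :=
  if n = 0 then 0 else if n ≤ k + 2 then n - 1 else if n = k + 3 then k + 1
  else if n ≤ 2 * k + 4 then n - (k + 4) else if n ≤ 4 * k + 6 then n - (2 * k + 4)
  else n - (3 * k + 5)

/-- A crossing on the Seifert circle with the number `l` in `leftLabel`: the side of the polygon for a
triangle, the first of the two edges for a bigon. -/
def leftRep (k l : ℕ) : ℕ := if l ≤ k + 1 then l + 1 else l + (2 * k + 4)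

/-- A numbering of the Seifert circles with crossings on the right, first the triangles. -/
def rightLabel (k n : ℕ) : ℕ :=
  if n ≤ k + 1 then n else if n = k + 2 then k + 1 else if n = k + 3 then 0
  else if n ≤ 2 * k + 4 then n - 2 else if n ≤ 3 * k + 5 then n - (k + 3)
  else if n ≤ 4 * k + 6 then n - (3 * k + 6) else n - (4 * k + 6)

/-- A crossing on the Seifert circle with the number `l` in `rightLabel`. -/
def rightRep (k l : ℕ) : ℕ := if l ≤ k + 1 then l else l + 2

theorem leftLabel_lt (hn : n < 5 * k + 8) : leftLabel k n < 2 * k + 3 := by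
  grind (splits := 20) [leftLabel]

theorem leftLabel_leftStep (hn : n < 5 * k + 8) :
    leftLabel k (leftStep k n) = leftLabel k n := by
  grind (splits := 20) [leftLabel, leftStep]

theorem leftRep_lt (hn : n < 2 * k + 3) : leftRep k n < 5 * k + 8 := by
  grind [leftRep]

theorem leftLabel_leftRep (hn : n < 2 * k + 3) : leftLabel k (leftRep k n) = n := by
  grind (splits := 20) [leftLabel, leftRep]

theorem leftRep_leftLabel (k n : ℕ) :
    n = leftRep k (leftLabel k n) ∨ leftStep k n = leftRep k (leftLabel k n) ∨
      leftStep k (leftRep k (leftLabel k n)) = n := by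
  grind (splits := 30) [leftLabel, leftStep, leftRep]

theorem rightLabel_lt (hn : n < 5 * k + 8) : rightLabel k n < 2 * k + 3 := by
  grind (splits := 20) [rightLabel]

theorem rightLabel_rightStep (hn : n < 5 * k + 8) :
    rightLabel k (rightStep k n) = rightLabel k n := by
  grind (splits := 20) [rightLabel, rightStep]

theorem rightRep_lt (hn : n < 2 * k + 3) : rightRep k n < 5 * k + 8 := by
  grind [rightRep]

theorem rightLabel_rightRep (hn : n < 2 * k + 3) : rightLabel k (rightRep k n) = n := by
  grind (splits := 20) [rightLabel, rightRep]

theorem rightRep_rightLabel (hn : n < 5 * k + 8) :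
    n = rightRep k (rightLabel k n) ∨ rightStep k n = rightRep k (rightLabel k n) ∨
      rightStep k (rightRep k (rightLabel k n)) = n := by
  grind (splits := 30) [rightLabel, rightStep, rightRep]

/-- The next crossing after `n` around the vertex at its northern corner. -/
def vertexStep (k n : ℕ) : ℕ :=
  if n = 0 then 4 * k + 7 else if n ≤ k + 2 then n + (2 * k + 4)
  else if n = k + 3 then 2 * k + 4 else if n ≤ 2 * k + 4 then n - 1
  else if n ≤ 3 * k + 4 then n + (2 * k + 3) else if n = 3 * k + 5 then k + 1
  else if n ≤ 4 * k + 5 then n + 1 else if n = 4 * k + 6 then k + 2 else n - (4 * k + 7)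

theorem rightBack_leftStep (hn : n < 5 * k + 8) :
    rightBack k (leftStep k n) = vertexStep k n := by
  grind (splits := 20) [rightBack, leftStep, vertexStep]

/-- The permutations of the crossings along the Seifert circles which have them on the left (`true`) or
on the right (`false`). -/
def familyPerm (k : ℕ) : Bool → Equiv.Perm (Fin (5 * k + 8))
  | true =>
    { toFun := fun n => ⟨leftStep k n, leftStep_lt n.2⟩
      invFun := fun n => ⟨leftBack k n, leftBack_lt n.2⟩
      left_inv := fun n => Fin.ext (leftBack_leftStep n.2)
      right_inv := fun n => Fin.ext (leftStep_leftBack n.2) }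
  | false =>
    { toFun := fun n => ⟨rightStep k n, rightStep_lt n.2⟩
      invFun := fun n => ⟨rightBack k n, rightBack_lt⟩
      left_inv := fun n => Fin.ext (rightBack_rightStep n.2)
      right_inv := fun n => Fin.ext (rightStep_rightBack n.2) }

theorem sameCycle_of_apply_eq {α : Type*} {f : Equiv.Perm α} {a b : α} (h : f a = b) :
    f.SameCycle a b := h ▸ f.sameCycle_self_apply a

theorem numCycles_familyPerm_true : numCycles (familyPerm k true) = 2 * k + 3 := by
  rw [numCycles_eq_card (familyPerm k true)
    (fun n => (⟨leftLabel k n, leftLabel_lt n.2⟩ : Fin (2 * k + 3)))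
    (fun l => ⟨leftRep k l, leftRep_lt l.2⟩)
    (fun n => Fin.ext (leftLabel_leftStep n.2)) (fun l => Fin.ext (leftLabel_leftRep l.2)) ?_,
    Nat.card_eq_fintype_card, Fintype.card_fin]
  intro n
  rcases leftRep_leftLabel k n with h | h | h
  · exact Eq.sameCycle (Fin.ext h) _
  · exact sameCycle_of_apply_eq (Fin.ext h)
  · exact (sameCycle_of_apply_eq (Fin.ext h)).symm

theorem numCycles_familyPerm_false : numCycles (familyPerm k false) = 2 * k + 3 := by
  rw [numCycles_eq_card (familyPerm k false)
    (fun n => (⟨rightLabel k n, rightLabel_lt n.2⟩ : Fin (2 * k + 3)))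
    (fun l => ⟨rightRep k l, rightRep_lt l.2⟩)
    (fun n => Fin.ext (rightLabel_rightStep n.2)) (fun l => Fin.ext (rightLabel_rightRep l.2)) ?_,
    Nat.card_eq_fintype_card, Fintype.card_fin]
  intro n
  rcases rightRep_rightLabel n.2 with h | h | h
  · exact Eq.sameCycle (Fin.ext h) _
  · exact sameCycle_of_apply_eq (Fin.ext h)
  · exact (sameCycle_of_apply_eq (Fin.ext h)).symm

theorem vertexPerm_familyPerm_apply (n : Fin (5 * k + 8)) :
    (vertexPerm (familyPerm k) n : ℕ) = vertexStep k n := rightBack_leftStep n.2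

theorem strandPerm_familyPerm_apply (n : Fin (5 * k + 8)) :
    (strandPerm (familyPerm k) n : ℕ) = strandStep k n := leftStep_rightStep n.2

theorem vertexLabel_vertexPerm (n : Fin (5 * k + 8)) :
    vertexLabel k (vertexPerm (familyPerm k) n) = vertexLabel k n := by
  change vertexLabel k (rightBack k (leftStep k n)) = _
  rw [vertexLabel_rightBack (leftStep_lt n.2), oppositeLabel_leftStep n.2]

theorem sameCycle_vertexPerm {a b : ℕ} (ha : a < 5 * k + 8) (hb : b < 5 * k + 8)
    (h : vertexStep k a = b) : (vertexPerm (familyPerm k)).SameCycle ⟨a, ha⟩ ⟨b, hb⟩ :=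
  sameCycle_of_apply_eq (Fin.ext ((vertexPerm_familyPerm_apply ⟨a, ha⟩).trans h))

theorem vertexStep_vertexLabel (hn : n < 5 * k + 8) :
    n = vertexLabel k n ∨ vertexStep k n = vertexLabel k n ∨ vertexStep k (vertexLabel k n) = n ∨
    (k + 3 < n ∧ n ≤ 2 * k + 4 ∧ vertexStep k n = n - 1 ∧ vertexLabel k n = k + 3) ∨
    (3 * k + 6 ≤ n ∧ n ≤ 4 * k + 5 ∧ vertexStep k n = n + 1 ∧ vertexLabel k n = k + 2) := by
  grind (splits := 30) [vertexStep, vertexLabel]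

/-- The edge numbered by the label of a vertex ends at this vertex. -/
theorem sameCycle_vertexLabel (n : Fin (5 * k + 8)) :
    (vertexPerm (familyPerm k)).SameCycle n
      ⟨vertexLabel k n, (vertexLabel_lt n.2).trans_le (by omega)⟩ := by
  have hdown : ∀ i, ∀ h : k + 3 + i < 5 * k + 8, i ≤ k + 1 →
      (vertexPerm (familyPerm k)).SameCycle ⟨k + 3 + i, h⟩ ⟨k + 3, by omega⟩ := by
    intro i
    induction i with
    | zero => intro h _; rfl
    | succ i ih =>
      intro h hi
      refine (sameCycle_vertexPerm h (by omega) ?_).trans (ih (by omega) (by omega))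
      grind [vertexStep]
  have hup : ∀ i, ∀ h : i ≤ k, (vertexPerm (familyPerm k)).SameCycle
      ⟨4 * k + 6 - i, by omega⟩ ⟨k + 2, by omega⟩ := by
    intro i
    induction i with
    | zero =>
      intro _
      refine sameCycle_vertexPerm _ _ ?_
      grind [vertexStep]
    | succ i ih =>
      intro hi
      refine (sameCycle_vertexPerm _ (by omega) ?_).trans (ih (by omega))
      grind [vertexStep]
  obtain ⟨n, hn⟩ := n
  rcases vertexStep_vertexLabel hn with h | h | h | h | h
  · exact Eq.sameCycle (Fin.ext h) _
  · exact sameCycle_vertexPerm _ _ h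
  · exact (sameCycle_vertexPerm _ _ h).symm
  · have h1 := hdown (n - (k + 3)) (by omega) (by omega)
    convert h1 using 2
    · omega
    · exact h.2.2.2
  · have h1 := hup (4 * k + 6 - n) (by omega)
    convert h1 using 2
    · omega
    · exact h.2.2.2

theorem numCycles_vertexPerm_familyPerm : numCycles (vertexPerm (familyPerm k)) = k + 4 := by
  rw [numCycles_eq_card (vertexPerm (familyPerm k))
    (fun n => (⟨vertexLabel k n, vertexLabel_lt n.2⟩ : Fin (k + 4)))
    (fun l => ⟨l, by omega⟩)
    (fun n => Fin.ext (vertexLabel_vertexPerm n)) (fun l => Fin.ext ?_) sameCycle_vertexLabel,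
    Nat.card_eq_fintype_card, Fintype.card_fin]
  have := l.2
  grind [vertexLabel]

theorem sameCycle_strandPerm {a b : ℕ} (ha : a < 5 * k + 8) (hb : b < 5 * k + 8)
    (h : strandStep k a = b) : (strandPerm (familyPerm k)).SameCycle ⟨a, ha⟩ ⟨b, hb⟩ :=
  sameCycle_of_apply_eq (Fin.ext ((strandPerm_familyPerm_apply ⟨a, ha⟩).trans h))

/-- All crossings lie on one strand.  It visits the sides of the polygon in steps of two, with an
outer and an inner edge in between, first the even and then, as `k` is odd, the odd ones; the remaining
edges follow one after another. -/
theorem sameCycle_strandPerm_zero (hk : Odd k) (n : Fin (5 * k + 8)) :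
    (strandPerm (familyPerm k)).SameCycle n ⟨0, by omega⟩ := by
  obtain ⟨j, hj⟩ := hk
  have htwo : ∀ i, ∀ h : i ≤ k, (strandPerm (familyPerm k)).SameCycle
      ⟨i, by omega⟩ ⟨i + 2, by omega⟩ := by
    intro i h
    refine (sameCycle_strandPerm (b := i + (4 * k + 7)) _ (by omega) ?_).trans
      ((sameCycle_strandPerm (b := i + (k + 4)) _ (by omega) ?_).trans
        (sameCycle_strandPerm _ _ ?_)) <;> grind [strandStep]
  have heven : ∀ t, ∀ h : 2 * t ≤ k + 2, (strandPerm (familyPerm k)).SameCycle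
      ⟨2 * t, by omega⟩ ⟨0, by omega⟩ := by
    intro t
    induction t with
    | zero => intro _; rfl
    | succ t ih => exact fun h => (htwo (2 * t) (by omega)).symm.trans (ih (by omega))
  have hlast : (strandPerm (familyPerm k)).SameCycle ⟨k + 3, by omega⟩ ⟨0, by omega⟩ := by
    have h1 := heven (j + 1) (by omega)
    refine (sameCycle_strandPerm (a := 2 * (j + 1)) (by omega) _ ?_).symm.trans h1
    grind [strandStep]
  have hone : (strandPerm (familyPerm k)).SameCycle ⟨1, by omega⟩ ⟨0, by omega⟩ := by
    refine (sameCycle_strandPerm (a := k + 3) (by omega) _ ?_).symm.trans hlast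
    grind [strandStep]
  have hodd : ∀ t, ∀ h : 2 * t + 1 ≤ k + 2, (strandPerm (familyPerm k)).SameCycle
      ⟨2 * t + 1, by omega⟩ ⟨0, by omega⟩ := by
    intro t
    induction t with
    | zero => intro _; exact hone
    | succ t ih => exact fun h => (htwo (2 * t + 1) (by omega)).symm.trans (ih (by omega))
  have hcycle : ∀ i, ∀ h : i ≤ k + 3, (strandPerm (familyPerm k)).SameCycle
      ⟨i, by omega⟩ ⟨0, by omega⟩ := by
    intro i h
    by_cases hi : i = k + 3
    · subst hi; exact hlast
    rcases Nat.even_or_odd' i with ⟨t, rfl | rfl⟩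
    · exact heven t (by omega)
    · exact hodd t (by omega)
  have hA : ∀ i, ∀ h : i ≤ k, (strandPerm (familyPerm k)).SameCycle
      ⟨i + (k + 4), by omega⟩ ⟨0, by omega⟩ := by
    intro i h
    refine (sameCycle_strandPerm (b := i + 2) _ (by omega) ?_).trans (hcycle _ (by omega))
    grind [strandStep]
  have hB' : ∀ i, ∀ h : i ≤ k, (strandPerm (familyPerm k)).SameCycle
      ⟨i + (4 * k + 7), by omega⟩ ⟨0, by omega⟩ := by
    intro i h
    refine (sameCycle_strandPerm _ (by omega) ?_).trans (hA i h)
    grind [strandStep]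
  have hmid : ∀ i, ∀ h : i ≤ 2 * k + 1, (strandPerm (familyPerm k)).SameCycle
      ⟨i + (2 * k + 5), by omega⟩ ⟨0, by omega⟩ := by
    intro i
    induction i with
    | zero =>
      intro h
      refine sameCycle_strandPerm _ _ ?_
      grind [strandStep]
    | succ i ih =>
      intro h
      refine (sameCycle_strandPerm _ (by omega) ?_).trans (ih (by omega))
      grind [strandStep]
  obtain ⟨n, hn⟩ := n
  by_cases h1 : n ≤ k + 3
  · exact hcycle n h1
  obtain h2 | h2 | h2 : (∃ i, i ≤ k ∧ n = i + (k + 4)) ∨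
      (∃ i, i ≤ 2 * k + 1 ∧ n = i + (2 * k + 5)) ∨ ∃ i, i ≤ k ∧ n = i + (4 * k + 7) := by
    by_cases h3 : n ≤ 2 * k + 4
    · exact Or.inl ⟨n - (k + 4), by omega, by omega⟩
    by_cases h4 : n ≤ 4 * k + 6
    · exact Or.inr (Or.inl ⟨n - (2 * k + 5), by omega, by omega⟩)
    · exact Or.inr (Or.inr ⟨n - (4 * k + 7), by omega, by omega⟩)
  · obtain ⟨i, hi, rfl⟩ := h2
    exact hA i hi
  · obtain ⟨i, hi, rfl⟩ := h2
    exact hmid i hi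
  · obtain ⟨i, hi, rfl⟩ := h2
    exact hB' i hi

theorem eulerChar_familyPerm : (special (familyPerm k)).eulerChar = -(k : ℤ) - 2 := by
  rw [eulerChar, numSeifertCircles_special, numCycles_familyPerm_true, numCycles_familyPerm_false,
    crossingNumber, Nat.card_eq_fintype_card, Fintype.card_fin]
  push_cast
  ring

theorem reduced_familyPerm : (special (familyPerm k)).Reduced := by
  refine special_reduced (v := fun n : Fin (5 * k + 8) => vertexLabel k n) _
    vertexLabel_vertexPerm fun n => ?_
  change vertexLabel k n ≠ vertexLabel k (rightBack k n)
  rw [vertexLabel_rightBack n.2]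
  exact vertexLabel_ne n.2

theorem irreducible_familyPerm : (special (familyPerm k)).Irreducible := by
  refine special_irreducible (v := fun n : Fin (5 * k + 8) => vertexLabel k n) _
    vertexLabel_vertexPerm (fun n => ⟨parallel k n, parallel_lt n.2⟩) fun n l h => ?_
  change s(vertexLabel k n, vertexLabel k (rightBack k n)) =
    s(vertexLabel k l, vertexLabel k (rightBack k l)) at h
  rw [vertexLabel_rightBack n.2, vertexLabel_rightBack l.2, Sym2.eq_iff] at h
  exact (eq_or_eq_parallel n.2 l.2 h).imp (fun e => Fin.ext e) fun e => Fin.ext e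

end Family

end DiagramCode

/-- The alternating knot diagram with `5 * k + 8` crossings of a triangulated polygon, for odd `k`.  In
the notation of `leftStep`, it comes from the Hamiltonian cycle `q 0, …, q (m + 1)` in a triangulation of
the sphere without multiple edges, all of whose other edges are doubled. -/
def ConnectedLinkDiagram.family {k : ℕ} (hk : Odd k) :
    ConnectedLinkDiagram (Fin (5 * k + 8)) where
  toDiagramCode := DiagramCode.special (DiagramCode.familyPerm k)
  connected := DiagramCode.special_connected _ (DiagramCode.sameCycle_strandPerm_zero hk)
  planar := by
    rw [DiagramCode.card_region_special, DiagramCode.numCycles_vertexPerm_familyPerm,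
      DiagramCode.numCycles_familyPerm_true, DiagramCode.numCycles_familyPerm_false,
      Nat.card_eq_fintype_card, Fintype.card_fin]
    omega

theorem theorem3p1 :
    (∀ (X : Type*) [Finite X] (D : ConnectedLinkDiagram X), D.Reduced →
      (D.eulerChar < 0 → (D.numSimClasses : ℤ) ≤ -3 * D.eulerChar) ∧
      (D.eulerChar = 0 → D.numSimClasses ≤ 1) ∧
      (D.Irreducible →
        (D.eulerChar = -1 → D.numComponents = 1 → D.crossingNumber ≤ 4) ∧
        (D.eulerChar = 0 → D.crossingNumber ≤ 2) ∧
        (D.eulerChar < 0 → (D.numComponents : ℤ) = 2 - D.eulerChar →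
          (D.crossingNumber : ℤ) ≤ -6 * D.eulerChar) ∧
        (D.eulerChar < 0 → (D.numComponents : ℤ) ≠ 2 - D.eulerChar →
          ¬ (D.eulerChar = -1 ∧ D.numComponents = 1) →
          (D.crossingNumber : ℤ) ≤ -5 * D.eulerChar + D.numComponents - 3))) ∧
    (∀ g : ℕ, 2 ≤ g →
      IsGreatest
        {c : ℕ | ∃ D : ConnectedLinkDiagram (Fin c),
          D.Reduced ∧ D.Alternating ∧ D.Irreducible ∧
          D.numComponents = 1 ∧ D.eulerChar = 1 - 2 * (g : ℤ)}
        (10 * g - 7)) := by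
  refine ⟨fun X _ D hred => D.bounds hred, fun g hg => ⟨?_, ?_⟩⟩
  · obtain ⟨j, rfl⟩ := Nat.exists_eq_add_of_le' hg
    have hc : 10 * (j + 2) - 7 = 5 * (2 * j + 1) + 8 := by omega
    rw [hc]
    refine ⟨ConnectedLinkDiagram.family (k := 2 * j + 1) ⟨j, rfl⟩, DiagramCode.reduced_familyPerm,
      DiagramCode.special_alternating _, DiagramCode.irreducible_familyPerm,
      DiagramCode.numComponents_special _ (DiagramCode.sameCycle_strandPerm_zero ⟨j, rfl⟩),
      DiagramCode.eulerChar_familyPerm.trans ?_⟩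
    push_cast
    ring
  · rintro c ⟨D, hred, -, hirr, hn, hχ⟩
    have h := (D.bounds hred).2.2 hirr
    have h1 := h.2.2.2 (by omega) (by omega) (by omega)
    have h2 : D.crossingNumber = c := by
      rw [DiagramCode.crossingNumber, Nat.card_eq_fintype_card, Fintype.card_fin]
    omega
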